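/- Let $\Delta=\{z\in\mathbb C:|z|<1\}$. A continuous function on a circle $\Gamma\subset\mathbb C$ is said to extend holomorphically from $\Gamma$ if it is the restriction to $\Gamma$ of a function that is continuous on the closed disc bounded by $\Gamma$ and holomorphic on its interior. Let $p_1,p_2\in\partial\Delta$ with $p_1\neq p_2$, let $0<r_j<1$ for $j=1,2$, and let $f:\overline\Delta\to\mathbb C$ be a continuous function which, for each $j=1,2$, extends holomorphically from each circle of radius $\rho$, $r_j\le\rho\le 1$, that is contained in $\overline\Delta$ and passes through $p_j$. If the smallest circles of these two families (that is, the circles of radius $r_1$ and $r_2$ contained in $\overline\Delta$ and passing through $p_1$ and $p_2$, respectively) are disjoint, then $f$ is holomorphic on $\Delta$. -/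

import Mathlib

/-- `f` extends holomorphically from the circle with centre `c` and radius `ρ` (used for `0 < ρ`):
some function that is continuous on the closed disc bounded by the circle and holomorphic on
the open disc coincides with `f` on the circle. -/
def ExtendsHolomorphicallyFrom (f : ℂ → ℂ) (c : ℂ) (ρ : ℝ) : Prop :=
  ∃ g : ℂ → ℂ, ContinuousOn g (Metric.closedBall c ρ) ∧
    DifferentiableOn ℂ g (Metric.ball c ρ) ∧ Set.EqOn g f (Metric.sphere c ρ)

/-- The circle with centre `c` and radius `ρ` is contained in the closed unit disc and
passes through `p`. -/
def IsCircleInDiscThrough (p c : ℂ) (ρ : ℝ) : Prop :=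
  Metric.sphere c ρ ⊆ Metric.closedBall 0 1 ∧ p ∈ Metric.sphere c ρ

/-! Subtract from `f` its holomorphic extension from the unit circle (the case ρ = 1). The
difference u vanishes on the unit circle, and the claim is that it vanishes on the disc. A Möbius
map takes the upper half-plane to the disc, ∞ to p₁ and 0 to p₂. Circles through p₁ become lines Im
z = t with t ≤ T₁; circles through p₂ become lines Im w = t with t ≤ T₂ in the coordinate w = -1/z.
Disjointness of the smallest circles gives T₁T₂ > 1. Write f₁, f₂ for u in the two coordinates,
extended by 0 below the real axis, and F₁ t, F₂ t for the extensions from the lines to the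
half-planes above.

For holomorphic k put Ψ(z) = ∫ F_t(z) k(z - 2it) dt over -1 ≤ t ≤ Im z. The integrand is holomorphic
in z, so only the moving endpoint contributes to ∂̄, and (∂x + i∂y)Ψ = i f(z) k(z̄)
(`HalfPlaneExt.approxDbar`). Take k(w) = 1/((w - a)(w - b)) for the first family and its transform
k₂ under inversion for the second. The two potentials solve the same ∂̄-equation, so Ψ₁(z) -
Ψ₂(-1/z) is holomorphic. It vanishes below the real axis, hence by continuation at iy for 1/T₂ < y <
T₁, a range that is nonempty because T₁T₂ > 1. This is the identity `integral_cauchy_kernel_eq`.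

Now let a and b cross the imaginary axis. The F₁ side jumps by a difference of values of F₁ t (iy)
at two parameters t, while the F₂ side does not jump, its poles being off the segment of
integration. So F₁ t (iy) does not depend on t in (0, y) (`eq_of_integral_cauchy_kernel_eq`); it
tends to 0 as t → 0, so it is 0. The identity theorem then kills F₁ t, hence f₁ below height T₁;
exchanging the families covers the rest. -/

open Complex Filter Topology Set Metric ComplexConjugate MeasureTheory Interval

/-! ### Extensions to half-planes and their joint continuity. -/

/-- `f` vanishes at infinity and, for each `t ≤ T`, extends holomorphically from the line
`Im z = t` to the half-plane above it, by a function `F t` vanishing at infinity. -/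
structure HalfPlaneExt (f : ℂ → ℂ) (T : ℝ) (F : ℝ → ℂ → ℂ) : Prop where
  cont : Continuous f
  tendsto : Tendsto f (cocompact ℂ) (𝓝 0)
  eq_zero : ∀ t ≤ 0, ∀ z, F t z = 0
  contF : ∀ t ≤ T, ContinuousOn (F t) {z | t ≤ z.im}
  diffF : ∀ t ≤ T, DifferentiableOn ℂ (F t) {z | t < z.im}
  tendstoF : ∀ t ≤ T, Tendsto (F t) (cocompact ℂ ⊓ 𝓟 {z | t ≤ z.im}) (𝓝 0)
  eqF : ∀ t ≤ T, ∀ z : ℂ, z.im = t → F t z = f z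

/-- Maximum principle on the upper half-plane for functions vanishing at infinity. -/
theorem norm_le_of_upperHalfPlane {u : ℂ → ℂ} {C : ℝ} (hC : 0 < C)
    (hc : ContinuousOn u {z | 0 ≤ z.im}) (hd : DifferentiableOn ℂ u {z | 0 < z.im})
    (ht : Tendsto u (cocompact ℂ ⊓ 𝓟 {z | 0 ≤ z.im}) (𝓝 0))
    (hb : ∀ z : ℂ, z.im = 0 → ‖u z‖ ≤ C) {z : ℂ} (hz : 0 ≤ z.im) : ‖u z‖ ≤ C := by
  have h1 : ∀ᶠ w in cocompact ℂ, 0 ≤ w.im → ‖u w‖ ≤ C := by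
    have := ht.eventually (Metric.closedBall_mem_nhds (0 : ℂ) hC)
    rw [eventually_inf_principal] at this
    filter_upwards [this] with w hw h
    simpa using hw h
  rw [← Metric.cobounded_eq_cocompact, ← comap_norm_atTop, eventually_comap] at h1
  obtain ⟨R, hR⟩ := eventually_atTop.1 h1
  -- The half-disc must contain z, and its arc must lie where the decay at infinity already gives
  -- the bound.
  let S := max R (‖z‖ + 1)
  let U : Set ℂ := {w | 0 < w.im} ∩ ball 0 S
  have hUo : IsOpen U := (isOpen_lt continuous_const continuous_im).inter isOpen_ball
  have hcl : closure U ⊆ {w | 0 ≤ w.im} ∩ closedBall 0 S := by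
    refine closure_minimal ?_ ((isClosed_le continuous_const continuous_im).inter
      isClosed_closedBall)
    exact inter_subset_inter (fun w (hw : 0 < w.im) => hw.le) ball_subset_closedBall
  have hdc : DiffContOnCl ℂ u U :=
    ⟨hd.mono inter_subset_left, hc.mono (hcl.trans inter_subset_left)⟩
  have hfr : ∀ w ∈ frontier U, ‖u w‖ ≤ C := by
    intro w hw
    rw [hUo.frontier_eq] at hw
    have h2 := hcl hw.1
    by_cases h0 : w.im = 0
    · exact hb w h0
    have h3 : w ∉ ball (0 : ℂ) S := fun h => hw.2 ⟨lt_of_le_of_ne h2.1 (Ne.symm h0), h⟩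
    have h4 : S ≤ ‖w‖ := by simpa using h3
    exact hR ‖w‖ ((le_max_left _ _).trans h4) w rfl h2.1
  rcases hz.eq_or_lt with h0 | h0
  · exact hb z h0.symm
  refine Complex.norm_le_of_forall_mem_frontier_norm_le (isBounded_ball.subset inter_subset_right)
    hdc hfr (subset_closure ⟨h0, ?_⟩)
  have : ‖z‖ + 1 ≤ S := le_max_right _ _
  simp; linarith

/-- After translating each half-plane to Im z ≥ 0, the maximum principle bounds the difference of
two extensions by the difference of `f` on the two lines, which is small because `f` is uniformly
continuous. -/
theorem HalfPlaneExt.continuousOn_uncurry {f : ℂ → ℂ} {T : ℝ} {F : ℝ → ℂ → ℂ}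
    (h : HalfPlaneExt f T F) :
    ContinuousOn (fun p : ℝ × ℂ => F p.1 p.2) {p | p.1 ≤ T ∧ p.1 ≤ p.2.im} := by
  have key : ∀ ε > 0, ∃ δ > 0, ∀ t ≤ T, ∀ s ≤ T, |t - s| < δ → ∀ z : ℂ, 0 ≤ z.im →
      ‖F t (z + t * I) - F s (z + s * I)‖ ≤ ε := by
    intro ε hε
    obtain ⟨δ, hδ, H⟩ := Metric.uniformContinuous_iff.1
      (h.cont.uniformContinuous_of_tendsto_cocompact h.tendsto) ε hε
    refine ⟨δ, hδ, fun t ht s hs hts z hz => ?_⟩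
    have hct : ∀ t ≤ T, ContinuousOn (fun z : ℂ => F t (z + t * I)) {z | 0 ≤ z.im} := by
      intro t ht
      exact (h.contF t ht).comp (by fun_prop) (fun w hw => by simpa using hw)
    have hdt : ∀ t ≤ T, DifferentiableOn ℂ (fun z : ℂ => F t (z + t * I)) {z | 0 < z.im} := by
      intro t ht
      exact (h.diffF t ht).comp (by fun_prop) (fun w hw => by simpa using hw)
    have htt : ∀ t ≤ T, Tendsto (fun z : ℂ => F t (z + t * I))
        (cocompact ℂ ⊓ 𝓟 {z | 0 ≤ z.im}) (𝓝 0) := by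
      intro t ht
      refine (h.tendstoF t ht).comp ?_
      refine tendsto_inf.2 ⟨?_, ?_⟩
      · exact ((Homeomorph.addRight (t * I : ℂ)).isClosedEmbedding.tendsto_cocompact).mono_left
          inf_le_left
      · refine tendsto_principal.2 ?_
        rw [eventually_inf_principal]
        exact Eventually.of_forall fun w hw => by simpa using hw
    refine norm_le_of_upperHalfPlane (u := fun z => F t (z + t * I) - F s (z + s * I)) hε
      ((hct t ht).sub (hct s hs)) ((hdt t ht).sub (hdt s hs))
      (by simpa using (htt t ht).sub (htt s hs)) (fun w hw => ?_) hz
    rw [h.eqF t ht _ (by simp [hw]), h.eqF s hs _ (by simp [hw])]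
    refine le_of_lt ?_
    rw [← dist_eq_norm]
    apply H
    rw [dist_eq_norm, show w + t * I - (w + s * I) = ((t - s : ℝ) : ℂ) * I by push_cast; ring]
    rw [norm_mul, norm_I, mul_one, norm_real]
    exact hts
  rintro ⟨s, w⟩ ⟨hs, hw⟩
  simp only at hs hw
  rw [ContinuousWithinAt, Metric.tendsto_nhds]
  intro ε hε
  obtain ⟨δ, hδ, H⟩ := key (ε / 2) (by linarith)
  have h1 : Tendsto (fun p : ℝ × ℂ => F s (p.2 - p.1 * I + s * I))
      (𝓝[{p | p.1 ≤ T ∧ p.1 ≤ p.2.im}] (s, w)) (𝓝 (F s w)) := by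
    have hcs := h.contF s hs w hw
    refine hcs.tendsto.comp ?_
    refine tendsto_nhdsWithin_iff.2 ⟨?_, ?_⟩
    · have : Continuous fun p : ℝ × ℂ => p.2 - p.1 * I + s * I := by fun_prop
      have := (this.tendsto (s, w)).mono_left
        (nhdsWithin_le_nhds (s := {p : ℝ × ℂ | p.1 ≤ T ∧ p.1 ≤ p.2.im}))
      simpa using this
    · filter_upwards [self_mem_nhdsWithin] with p hp
      simpa using hp.2
  have h2 : ∀ᶠ p : ℝ × ℂ in 𝓝[{p | p.1 ≤ T ∧ p.1 ≤ p.2.im}] (s, w), |p.1 - s| < δ := by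
    refine nhdsWithin_le_nhds ?_
    have : Tendsto (fun p : ℝ × ℂ => p.1) (𝓝 (s, w)) (𝓝 s) := continuous_fst.tendsto _
    exact this.eventually (Metric.ball_mem_nhds s hδ)
  filter_upwards [h2, Metric.tendsto_nhds.1 h1 (ε / 2) (by linarith), self_mem_nhdsWithin]
    with p hp1 hp2 hp3
  have h3 := H p.1 hp3.1 s hs hp1 (p.2 - p.1 * I) (by simpa using hp3.2)
  rw [sub_add_cancel, ← dist_eq_norm] at h3
  linarith [dist_triangle (F p.1 p.2) (F s (p.2 - p.1 * I + s * I)) (F s w)]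

/-! ### The ∂̄-equation in a weak sense, and Morera's theorem. -/

/-- `Φ` is a uniform limit on `K` of real differentiable functions `Ψ` for which
`∂Ψ/∂x + i ∂Ψ/∂y` is continuous on `K` and converges to `g` uniformly on `K`. -/
def ApproxDbar (Φ g : ℂ → ℂ) (K : Set ℂ) : Prop :=
  ∀ ε > 0, ∃ (Ψ : ℂ → ℂ) (L : ℂ → ℂ →L[ℝ] ℂ), (∀ z ∈ K, HasFDerivAt Ψ (L z) z) ∧
    ContinuousOn (fun z => L z 1 + I * L z I) K ∧
    ∀ z ∈ K, ‖Ψ z - Φ z‖ ≤ ε ∧ ‖L z 1 + I * L z I - g z‖ ≤ ε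

theorem ApproxDbar.continuousOn {Φ g : ℂ → ℂ} {K : Set ℂ} (h : ApproxDbar Φ g K) :
    ContinuousOn Φ K := by
  refine continuousOn_of_uniform_approx_of_continuousOn fun u hu => ?_
  obtain ⟨ε, hε, hεu⟩ := Metric.mem_uniformity_dist.1 hu
  obtain ⟨Ψ, L, h1, -, h3⟩ := h (ε / 2) (by linarith)
  refine ⟨Ψ, fun z hz => (h1 z hz).continuousAt.continuousWithinAt, fun z hz => hεu ?_⟩
  rw [dist_comm, dist_eq_norm]
  linarith [(h3 z hz).1]

theorem ApproxDbar.sub {Φ₁ g₁ Φ₂ g₂ : ℂ → ℂ} {K : Set ℂ} (h₁ : ApproxDbar Φ₁ g₁ K)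
    (h₂ : ApproxDbar Φ₂ g₂ K) : ApproxDbar (fun z => Φ₁ z - Φ₂ z) (fun z => g₁ z - g₂ z) K := by
  intro ε hε
  obtain ⟨Ψ₁, L₁, d₁, c₁, e₁⟩ := h₁ (ε / 2) (by linarith)
  obtain ⟨Ψ₂, L₂, d₂, c₂, e₂⟩ := h₂ (ε / 2) (by linarith)
  have key : ∀ z, (L₁ z - L₂ z) 1 + I * (L₁ z - L₂ z) I =
      (L₁ z 1 + I * L₁ z I) - (L₂ z 1 + I * L₂ z I) := by
    intro z; simp; ring
  refine ⟨fun z => Ψ₁ z - Ψ₂ z, fun z => L₁ z - L₂ z, fun z hz => (d₁ z hz).sub (d₂ z hz), ?_,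
    fun z hz => ⟨?_, ?_⟩⟩
  · simp only [key]; exact c₁.sub c₂
  · rw [show Ψ₁ z - Ψ₂ z - (Φ₁ z - Φ₂ z) = (Ψ₁ z - Φ₁ z) - (Ψ₂ z - Φ₂ z) by ring]
    linarith [norm_sub_le (Ψ₁ z - Φ₁ z) (Ψ₂ z - Φ₂ z), (e₁ z hz).1, (e₂ z hz).1]
  · rw [key, show ∀ a b c d : ℂ, a - b - (c - d) = (a - c) - (b - d) by intros; ring]
    refine (norm_sub_le _ _).trans ?_
    linarith [(e₁ z hz).2, (e₂ z hz).2]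

/-- Chain rule for ∂̄ under a holomorphic map with derivative `c`: only the conjugate-linear part of
`L` survives in L 1 + i L i, and it turns `c` into its conjugate. -/
theorem ContinuousLinearMap.apply_add_I_mul_apply (L : ℂ →L[ℝ] ℂ) (c : ℂ) :
    L c + I * L (c * I) = conj c * (L 1 + I * L I) := by
  have h1 : L c = c.re * L 1 + c.im * L I := by
    conv_lhs => rw [show c = c.re • (1 : ℂ) + c.im • I from (by simp [re_add_im])]
    rw [map_add, map_smul, map_smul, real_smul, real_smul]
  have h2 : L (c * I) = c.re * L I - c.im * L 1 := by
    conv_lhs => rw [show c * I = c.re • I + (-c.im) • (1 : ℂ) from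
      (by apply Complex.ext <;> simp)]
    rw [map_add, map_smul, map_smul, real_smul, real_smul]
    push_cast; ring
  have h3 : conj c = c.re - c.im * I := by
    apply Complex.ext <;> simp
  rw [h1, h2, h3]
  linear_combination ((c.im : ℂ) * L I) * I_mul_I

theorem ApproxDbar.comp {Φ g φ φ' : ℂ → ℂ} {K K' : Set ℂ} (h : ApproxDbar Φ g K')
    (hK : IsCompact K) (hφ : ∀ z ∈ K, HasDerivAt φ (φ' z) z) (hφ' : ContinuousOn φ' K)
    (hm : MapsTo φ K K') : ApproxDbar (fun z => Φ (φ z)) (fun z => conj (φ' z) * g (φ z)) K := by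
  intro ε hε
  obtain ⟨C, hC⟩ := hK.exists_bound_of_continuousOn hφ'
  have hC' : 0 < max C 1 := lt_of_lt_of_le one_pos (le_max_right _ _)
  have hε' : 0 < ε / max C 1 := by positivity
  obtain ⟨Ψ, L, d, c, e⟩ := h (ε / max C 1) hε'
  let D : ℂ → ℂ →L[ℝ] ℂ := fun z =>
    (ContinuousLinearMap.toSpanSingleton ℂ (φ' z)).restrictScalars ℝ
  have key : ∀ z, ((L (φ z)).comp (D z)) 1 + I * ((L (φ z)).comp (D z)) I =
      conj (φ' z) * (L (φ z) 1 + I * L (φ z) I) := by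
    intro z
    rw [← ContinuousLinearMap.apply_add_I_mul_apply]
    simp [D, mul_comm]
  have hφc : ContinuousOn φ K := fun z hz => (hφ z hz).continuousAt.continuousWithinAt
  refine ⟨fun z => Ψ (φ z), fun z => (L (φ z)).comp (D z), fun z hz => ?_, ?_, fun z hz => ⟨?_, ?_⟩⟩
  · exact (d _ (hm hz)).comp z ((hφ z hz).hasFDerivAt.restrictScalars ℝ)
  · simp only [key]
    exact (continuous_conj.comp_continuousOn hφ').mul (c.comp hφc hm)
  · exact (e _ (hm hz)).1.trans (div_le_self hε.le (le_max_right _ _))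
  · rw [key, ← mul_sub, norm_mul, norm_conj]
    calc _ ≤ max C 1 * (ε / max C 1) :=
          mul_le_mul ((hC z hz).trans (le_max_left _ _)) (e _ (hm hz)).2 (norm_nonneg _) hC'.le
      _ = ε := by field_simp

/-- By Green's formula the integral of an approximant around a rectangle equals an area integral of
its ∂̄, which is at most ε times the area. In the limit the rectangle integrals of `Φ` vanish, and
Morera applies. -/
theorem ApproxDbar.differentiableOn {Φ g : ℂ → ℂ} {U : Set ℂ} (hU : IsOpen U)
    (hg : ∀ z ∈ U, g z = 0) (h : ∀ K ⊆ U, IsCompact K → ApproxDbar Φ g K) :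
    DifferentiableOn ℂ Φ U := by
  have hc : ContinuousOn Φ U := by
    intro z hz
    obtain ⟨K, hK, hzK, hKU⟩ := exists_compact_subset hU hz
    exact ((h K hKU hK).continuousOn.continuousAt
      (mem_interior_iff_mem_nhds.1 hzK)).continuousWithinAt
  refine (isConservativeOn_and_continuousOn_iff_isDifferentiableOn hU).1 ⟨?_, hc⟩
  intro z w hzw
  rw [← add_eq_zero_iff_eq_neg, wedgeIntegral_add_wedgeIntegral_eq]
  let B : (ℂ → ℂ) → ℂ := fun f => (∫ x : ℝ in z.re..w.re, f (x + z.im * I)) -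
      (∫ x : ℝ in z.re..w.re, f (x + w.im * I)) +
      I • (∫ y : ℝ in z.im..w.im, f (w.re + y * I)) -
      I • (∫ y : ℝ in z.im..w.im, f (z.re + y * I))
  change B Φ = 0
  set R : Set ℂ := [[z.re, w.re]] ×ℂ [[z.im, w.im]] with hR
  have hRc : IsCompact R := isCompact_uIcc.reProdIm isCompact_uIcc
  have hRU : R ⊆ U := hzw
  have mh : ∀ x ∈ [[z.re, w.re]], ∀ y ∈ [[z.im, w.im]], (x + y * I : ℂ) ∈ R := by
    intro x hx y hy
    rw [hR, mem_reProdIm]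
    simpa using ⟨hx, hy⟩
  have iH : ∀ f : ℂ → ℂ, ContinuousOn f R → ∀ y ∈ [[z.im, w.im]],
      IntervalIntegrable (fun x : ℝ => f (x + y * I)) volume z.re w.re := by
    intro f hf y hy
    exact (hf.comp (by fun_prop) (fun x hx => mh x hx y hy)).intervalIntegrable
  have iV : ∀ f : ℂ → ℂ, ContinuousOn f R → ∀ x ∈ [[z.re, w.re]],
      IntervalIntegrable (fun y : ℝ => f (x + y * I)) volume z.im w.im := by
    intro f hf x hx
    exact (hf.comp (by fun_prop) (fun y hy => mh x hx y hy)).intervalIntegrable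
  have hsub : ∀ f₁ f₂ : ℂ → ℂ, ContinuousOn f₁ R → ContinuousOn f₂ R →
      B (fun z => f₁ z - f₂ z) = B f₁ - B f₂ := by
    intro f₁ f₂ h₁ h₂
    simp only [B]
    rw [intervalIntegral.integral_sub (iH f₁ h₁ _ left_mem_uIcc) (iH f₂ h₂ _ left_mem_uIcc),
      intervalIntegral.integral_sub (iH f₁ h₁ _ right_mem_uIcc) (iH f₂ h₂ _ right_mem_uIcc),
      intervalIntegral.integral_sub (iV f₁ h₁ _ left_mem_uIcc) (iV f₂ h₂ _ left_mem_uIcc),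
      intervalIntegral.integral_sub (iV f₁ h₁ _ right_mem_uIcc) (iV f₂ h₂ _ right_mem_uIcc)]
    simp only [smul_eq_mul]
    ring
  set a := |w.re - z.re|
  set b := |w.im - z.im|
  have hBn : ∀ (f : ℂ → ℂ) (ε : ℝ), (∀ z ∈ R, ‖f z‖ ≤ ε) → ‖B f‖ ≤ ε * (2 * a + 2 * b) := by
    intro f ε hf
    have n1 : ∀ y ∈ [[z.im, w.im]], ‖∫ x : ℝ in z.re..w.re, f (x + y * I)‖ ≤ ε * a := by
      intro y hy
      exact intervalIntegral.norm_integral_le_of_norm_le_const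
        fun x hx => hf _ (mh x (uIoc_subset_uIcc hx) y hy)
    have n2 : ∀ x ∈ [[z.re, w.re]], ‖∫ y : ℝ in z.im..w.im, f (x + y * I)‖ ≤ ε * b := by
      intro x hx
      exact intervalIntegral.norm_integral_le_of_norm_le_const
        fun y hy => hf _ (mh x hx y (uIoc_subset_uIcc hy))
    have m1 := n1 _ left_mem_uIcc
    have m2 := n1 _ right_mem_uIcc
    have m3 := n2 _ left_mem_uIcc
    have m4 := n2 _ right_mem_uIcc
    simp only [B]
    refine (norm_sub_le _ _).trans ?_
    refine (add_le_add_left ((norm_add_le _ _).trans (add_le_add_left (norm_sub_le _ _) _)) _).trans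
      ?_
    rw [norm_smul, norm_smul, norm_I]
    linarith
  have main : ∀ ε > 0, ‖B Φ‖ ≤ ε * (2 * a + 2 * b + a * b) := by
    intro ε hε
    obtain ⟨Ψ, L, d, c, e⟩ := h R hRU hRc ε hε
    have hΨc : ContinuousOn Ψ R := fun z hz => (d z hz).continuousAt.continuousWithinAt
    have hID : ∀ z, I • L z 1 - L z I = I * (L z 1 + I * L z I) := by
      intro z
      simp only [smul_eq_mul]
      linear_combination (-L z I) * I_mul_I
    have h1 := integral_boundary_rect_of_continuousOn_of_hasFDerivAt_real Ψ L z w hΨc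
      (fun x hx => d x ⟨Ioo_subset_Icc_self hx.1, Ioo_subset_Icc_self hx.2⟩)
      (by
        simp only [hID]
        exact (continuousOn_const.mul c).integrableOn_compact hRc)
    have h2 : ‖B Ψ‖ ≤ ε * (a * b) := by
      change B Ψ = _ at h1
      rw [h1, show ε * (a * b) = (ε * b) * a by ring]
      refine intervalIntegral.norm_integral_le_of_norm_le_const fun x hx => ?_
      refine intervalIntegral.norm_integral_le_of_norm_le_const fun y hy => ?_
      have hm := mh x (uIoc_subset_uIcc hx) y (uIoc_subset_uIcc hy)
      rw [hID, norm_mul, norm_I, one_mul]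
      have := (e _ hm).2
      rwa [hg _ (hRU hm), sub_zero] at this
    have h3 := hBn (fun z => Ψ z - Φ z) ε (fun z hz => (e z hz).1)
    rw [hsub Ψ Φ hΨc (hc.mono hRU)] at h3
    have : ‖B Φ‖ ≤ ‖B Ψ‖ + ‖B Ψ - B Φ‖ := by
      calc ‖B Φ‖ = ‖B Ψ - (B Ψ - B Φ)‖ := by congr 1; ring
        _ ≤ _ := norm_sub_le _ _
    linarith
  rw [← norm_le_zero_iff]
  refine le_of_forall_pos_le_add fun ε hε => ?_
  have hpos : 0 < 2 * a + 2 * b + a * b + 1 := by positivity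
  have := main (ε / (2 * a + 2 * b + a * b + 1)) (by positivity)
  rw [zero_add]
  refine this.trans ?_
  rw [div_mul_eq_mul_div, div_le_iff₀ hpos]
  nlinarith

/-! ### Differentiating parameter integrals, and the ∂̄-potential. -/

theorem exists_hasDerivAt_intervalIntegral {K : ℝ → ℂ → ℂ} {a b r : ℝ} {z₀ : ℂ} (hr : 0 < r)
    (hc : ContinuousOn (fun p : ℝ × ℂ => K p.1 p.2) (uIcc a b ×ˢ closedBall z₀ r))
    (hd : ∀ t ∈ uIcc a b, DifferentiableOn ℂ (K t) (ball z₀ r)) :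
    ∃ D : ℂ, HasDerivAt (fun z => ∫ t in a..b, K t z) D z₀ := by
  obtain ⟨C, hC⟩ := (isCompact_uIcc.prod (isCompact_closedBall z₀ r)).exists_bound_of_continuousOn hc
  have hs : ∀ z ∈ closedBall z₀ r, ContinuousOn (fun t => K t z) (uIcc a b) := fun z hz =>
    hc.comp (f := fun t : ℝ => (t, z)) (by fun_prop) (fun t ht => ⟨ht, hz⟩)
  have hmeas : ∀ z ∈ closedBall z₀ r,
      AEStronglyMeasurable (fun t => K t z) (volume.restrict (Ι a b)) := fun z hz =>
    ((hs z hz).mono uIoc_subset_uIcc).aestronglyMeasurable measurableSet_uIoc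
  have hda : ∀ t ∈ uIcc a b, ∀ z ∈ ball z₀ r, HasDerivAt (K t) (deriv (K t) z) z :=
    fun t ht z hz => ((hd t ht).differentiableAt (isOpen_ball.mem_nhds hz)).hasDerivAt
  refine ⟨∫ t in a..b, deriv (K t) z₀, (intervalIntegral.hasDerivAt_integral_of_dominated_loc_of_deriv_le
    (F := fun z t => K t z) (F' := fun z t => deriv (K t) z) (bound := fun _ => C / (r / 2))
    (ball_mem_nhds z₀ (half_pos hr)) ?_ ?_ ?_ ?_ ?_ ?_).2⟩
  · filter_upwards [closedBall_mem_nhds z₀ hr] with z hz using hmeas z hz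
  · exact (hs z₀ (mem_closedBall_self hr.le)).intervalIntegrable
  -- The derivative is measurable in t as a limit of difference quotients along a sequence of steps
  -- tending to 0.
  · obtain ⟨u, -, hu0, hu⟩ := exists_seq_strictAnti_tendsto' (half_pos hr)
    have hur : ∀ n, z₀ + (u n : ℂ) ∈ closedBall z₀ r := by
      intro n
      have := hu0 n
      simp [abs_of_pos this.1]
      linarith [this.2]
    refine aestronglyMeasurable_of_tendsto_ae atTop
      (f := fun n t => (u n : ℂ)⁻¹ • (K t (z₀ + (u n : ℂ)) - K t z₀))
      (fun n => (((hmeas _ (hur n)).sub (hmeas _ (mem_closedBall_self hr.le))).const_smul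
        ((u n : ℂ)⁻¹))) ?_
    filter_upwards [ae_restrict_mem measurableSet_uIoc] with t ht
    have h1 := (hda t (uIoc_subset_uIcc ht) z₀ (mem_ball_self hr)).tendsto_slope_zero
    refine h1.comp (tendsto_nhdsWithin_iff.2 ⟨?_, ?_⟩)
    · exact (continuous_ofReal.tendsto' 0 0 (by simp)).comp hu
    · exact Eventually.of_forall fun n => by simpa using (hu0 n).1.ne'
  · refine Eventually.of_forall fun t ht z hz => ?_
    have ht' := uIoc_subset_uIcc ht
    have hsub : closedBall z (r / 2) ⊆ ball z₀ r := by
      intro w hw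
      have h1 : dist w z ≤ r / 2 := hw
      have h2 : dist z z₀ < r / 2 := hz
      have := dist_triangle w z z₀
      simp only [mem_ball]; linarith
    refine Complex.norm_deriv_le_of_forall_mem_sphere_norm_le (half_pos hr) ?_ ?_
    · refine DifferentiableOn.diffContOnCl ?_
      rw [closure_ball _ (half_pos hr).ne']
      exact (hd t ht').mono hsub
    · intro w hw
      exact hC (t, w) ⟨ht', ball_subset_closedBall (hsub (sphere_subset_closedBall hw))⟩
  · exact intervalIntegrable_const
  · refine Eventually.of_forall fun t ht z hz => ?_
    exact hda t (uIoc_subset_uIcc ht) z (ball_subset_ball (by linarith) hz)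

/-- With the endpoint frozen the integral is holomorphic in z, so its ∂̄ vanishes. The moving
endpoint adds `K` times d(Im z), and Im z contributes the factor i. -/
theorem exists_hasFDerivAt_intervalIntegral_im {K : ℝ → ℂ → ℂ} {a r : ℝ} {z₀ : ℂ} (hr : 0 < r)
    (ha : a < z₀.im)
    (hc : ContinuousOn (fun p : ℝ × ℂ => K p.1 p.2) (Icc a (z₀.im + r) ×ˢ closedBall z₀ r))
    (hd : ∀ t ∈ Icc a z₀.im, DifferentiableOn ℂ (K t) (ball z₀ r)) :
    ∃ L : ℂ →L[ℝ] ℂ, HasFDerivAt (fun z : ℂ => ∫ t in a..z.im, K t z) L z₀ ∧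
      L 1 + I * L I = I * K z₀.im z₀ := by
  obtain ⟨D, hD⟩ := exists_hasDerivAt_intervalIntegral (K := K) (a := a) (b := z₀.im) hr
    (hc.mono (prod_mono (by rw [uIcc_of_le ha.le]; exact Icc_subset_Icc_right (by linarith))
      subset_rfl))
    (by rwa [uIcc_of_le ha.le])
  set c₀ := K z₀.im z₀
  set L₂ : ℂ →L[ℝ] ℂ := imCLM.smulRight c₀
  have him : ∀ z ∈ ball z₀ r, |z.im - z₀.im| < r := fun z hz =>
    (abs_im_le_norm (z - z₀)).trans_lt (by simpa [dist_eq_norm] using hz)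
  have ev : ∀ᶠ z in 𝓝 z₀, z ∈ ball z₀ (min r (z₀.im - a)) :=
    ball_mem_nhds _ (lt_min hr (by linarith))
  have hint : ∀ z ∈ ball z₀ (min r (z₀.im - a)), ∀ p ∈ Icc a (z₀.im + r), ∀ q ∈ Icc a (z₀.im + r),
      IntervalIntegrable (fun t => K t z) volume p q := by
    intro z hz p hp q hq
    refine ContinuousOn.intervalIntegrable ?_
    refine hc.comp (f := fun t : ℝ => (t, z)) (by fun_prop) (fun t ht => ⟨?_, ?_⟩)
    · exact (uIcc_subset_Icc hp hq) ht
    · exact ball_subset_closedBall (ball_subset_ball (min_le_left _ _) hz)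
  have m1 : z₀.im ∈ Icc a (z₀.im + r) := ⟨ha.le, by linarith⟩
  have m2 : ∀ z ∈ ball z₀ (min r (z₀.im - a)), z.im ∈ Icc a (z₀.im + r) := by
    intro z hz
    have h1 := (abs_im_le_norm (z - z₀)).trans_lt (mem_ball_iff_norm.1 hz)
    rw [sub_im, abs_lt] at h1
    have h2 := min_le_left r (z₀.im - a)
    have h3 := min_le_right r (z₀.im - a)
    exact ⟨by linarith, by linarith⟩
  have m0 : a ∈ Icc a (z₀.im + r) := ⟨le_rfl, by linarith⟩
  have hE : HasFDerivAt (fun z : ℂ => ∫ t in z₀.im..z.im, K t z) L₂ z₀ := by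
    rw [hasFDerivAt_iff_isLittleO, Asymptotics.isLittleO_iff]
    intro ε hε
    have hca := hc (z₀.im, z₀) ⟨m1, mem_closedBall_self hr.le⟩
    obtain ⟨δ, hδ, H⟩ := Metric.continuousWithinAt_iff.1 hca ε hε
    filter_upwards [ev, ball_mem_nhds z₀ hδ] with z hz hzδ
    rw [intervalIntegral.integral_same, sub_zero]
    have h1 : L₂ (z - z₀) = ∫ t in z₀.im..z.im, c₀ := by
      simp [L₂]
    rw [h1, ← intervalIntegral.integral_sub (hint z hz _ m1 _ (m2 z hz)) intervalIntegrable_const]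
    have h2 := intervalIntegral.norm_integral_le_of_norm_le_const (a := z₀.im) (b := z.im)
      (f := fun t => K t z - c₀) (C := ε) ?_
    · refine h2.trans (mul_le_mul_of_nonneg_left ?_ hε.le)
      exact abs_im_le_norm (z - z₀)
    · intro t ht
      have ht' := uIcc_subset_Icc m1 (m2 z hz) (uIoc_subset_uIcc ht)
      have hz' : z ∈ closedBall z₀ r :=
        ball_subset_closedBall (ball_subset_ball (min_le_left _ _) hz)
      have := H (x := (t, z)) ⟨ht', hz'⟩ ?_
      · rw [dist_eq_norm] at this; exact this.le
      rw [Prod.dist_eq]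
      refine max_lt ?_ hzδ
      refine lt_of_le_of_lt ?_ hzδ
      refine le_trans ?_ ((abs_im_le_norm (z - z₀)).trans_eq (dist_eq_norm _ _).symm)
      rw [Real.dist_eq, sub_im]
      simpa using abs_sub_left_of_mem_uIcc (uIoc_subset_uIcc ht)
  refine ⟨(ContinuousLinearMap.toSpanSingleton ℂ D).restrictScalars ℝ + L₂, ?_, ?_⟩
  · refine ((hD.hasFDerivAt.restrictScalars ℝ).add hE).congr_of_eventuallyEq ?_
    filter_upwards [ev] with z hz
    exact (intervalIntegral.integral_add_adjacent_intervals (hint z hz _ m0 _ m1)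
      (hint z hz _ m1 _ (m2 z hz))).symm
  · simp [L₂]
    linear_combination D * I_mul_I

/-- F t need not be differentiable on its boundary line, which the endpoint t = Im z reaches. The
approximants use F t (z + iδ), holomorphic past that line; at the endpoint z - 2i Im z is the
conjugate of z. -/
theorem HalfPlaneExt.approxDbar {f : ℂ → ℂ} {T : ℝ} {F : ℝ → ℂ → ℂ} (h : HalfPlaneExt f T F)
    {J : Set ℝ} (hJ : IsOpen J) {k : ℂ → ℂ} (hk : DifferentiableOn ℂ k {w | w.re ∈ J}) {K : Set ℂ}
    (hK : IsCompact K) (hKs : ∀ z ∈ K, -1 < z.im ∧ z.im < T ∧ z.re ∈ J) :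
    ApproxDbar (fun z => ∫ t in (-1 : ℝ)..z.im, F t z * k (z - 2 * t * I))
      (fun z => I * (f z * k (conj z))) K := by
  intro ε hε
  have hF := h.continuousOn_uncurry
  set ε' := ε / (|T + 1| + 1) with hε'
  have hε'0 : 0 < ε' := by positivity
  have hε'1 : ε' * (|T + 1| + 1) = ε := by rw [hε']; field_simp
  have hε'2 : ε' ≤ ε := by nlinarith [abs_nonneg (T + 1)]
  have cF : ContinuousOn (fun p : ℝ × ℂ × ℝ => F p.1 (p.2.1 + p.2.2 * I) * k (p.2.1 - 2 * p.1 * I))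
      {p | p.1 ≤ T ∧ p.1 ≤ p.2.1.im + p.2.2 ∧ p.2.1.re ∈ J} := by
    refine ContinuousOn.mul ?_ ?_
    · exact hF.comp (f := fun p : ℝ × ℂ × ℝ => (p.1, p.2.1 + p.2.2 * I)) (by fun_prop)
        (fun p hp => ⟨hp.1, by simpa using hp.2.1⟩)
    · exact hk.continuousOn.comp (by fun_prop) (fun p hp => by simpa using hp.2.2)
  -- The third coordinate is the vertical shift; uniform continuity on this compact set makes one δ
  -- work for all z in `K` and all t.
  set Q : Set (ℝ × ℂ × ℝ) := {p | p.1 ≤ p.2.1.im} ∩ (Icc (-1) T ×ˢ K ×ˢ Icc 0 1) with hQ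
  have hQc : IsCompact Q :=
    (isCompact_Icc.prod (hK.prod isCompact_Icc)).inter_left
      (isClosed_le (by fun_prop) (by fun_prop))
  have hQs : Q ⊆ {p | p.1 ≤ T ∧ p.1 ≤ p.2.1.im + p.2.2 ∧ p.2.1.re ∈ J} := by
    rintro p ⟨h1, h2, h3, h4⟩
    have h1' : p.1 ≤ p.2.1.im := h1
    exact ⟨h2.2, by linarith [h4.1], (hKs _ h3).2.2⟩
  obtain ⟨δ₀, hδ₀, H⟩ := Metric.uniformContinuousOn_iff.1
    (hQc.uniformContinuousOn_of_continuous (cF.mono hQs)) ε' hε'0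
  set δ := min (δ₀ / 2) 1 with hδd
  have hδ : 0 < δ := by positivity
  have hδ1 : δ ≤ 1 := min_le_right _ _
  have hδ2 : δ < δ₀ := lt_of_le_of_lt (min_le_left _ _) (by linarith)
  have close : ∀ z ∈ K, ∀ t ∈ Icc (-1) z.im,
      ‖F t (z + δ * I) * k (z - 2 * t * I) - F t z * k (z - 2 * t * I)‖ ≤ ε' := by
    intro z hz t ht
    have q1 : ∀ d ∈ Icc (0 : ℝ) 1, (t, z, d) ∈ Q := fun d hd =>
      ⟨ht.2, ⟨ht.1, ht.2.trans (hKs z hz).2.1.le⟩, hz, hd⟩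
    have := H (t, z, δ) (q1 δ ⟨hδ.le, hδ1⟩) (t, z, 0) (q1 0 ⟨le_rfl, zero_le_one⟩) (by
      simpa [Prod.dist_eq, abs_of_pos hδ] using ⟨hδ₀, hδ2⟩)
    rw [dist_eq_norm] at this
    simpa using this.le
  have hder : ∀ z₀ ∈ K, ∃ L : ℂ →L[ℝ] ℂ,
      HasFDerivAt (fun z : ℂ => ∫ t in (-1 : ℝ)..z.im, F t (z + δ * I) * k (z - 2 * t * I)) L z₀ ∧
      L 1 + I * L I = I * (F z₀.im (z₀ + δ * I) * k (z₀ - 2 * z₀.im * I)) := by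
    intro z₀ hz₀
    obtain ⟨h1, h2, h3⟩ := hKs z₀ hz₀
    obtain ⟨r₁, hr₁, hr₁J⟩ := Metric.isOpen_iff.1 hJ _ h3
    set r := min (r₁ / 2) (min (δ / 2) (T - z₀.im)) with hrd
    have hr : 0 < r := lt_min (by linarith) (lt_min (by linarith) (by linarith))
    have hra : r ≤ r₁ / 2 := min_le_left _ _
    have hrb : r ≤ δ / 2 := (min_le_right _ _).trans (min_le_left _ _)
    have hrc : r ≤ T - z₀.im := (min_le_right _ _).trans (min_le_right _ _)
    have hre : ∀ z ∈ closedBall z₀ r, z.re ∈ J := by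
      intro z hz
      apply hr₁J
      have := (abs_re_le_norm (z - z₀)).trans (by simpa [dist_eq_norm] using hz)
      rw [Metric.mem_ball, Real.dist_eq, ← sub_re]
      linarith
    refine exists_hasFDerivAt_intervalIntegral_im
      (K := fun t z => F t (z + δ * I) * k (z - 2 * t * I)) hr h1 ?_ ?_
    · refine cF.comp (f := fun p : ℝ × ℂ => (p.1, p.2, δ)) (by fun_prop) ?_
      rintro ⟨t, z⟩ ⟨ht, hz⟩
      have hz' : z ∈ closedBall z₀ r := hz
      have := (abs_im_le_norm (z - z₀)).trans (by simpa [dist_eq_norm] using hz')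
      rw [sub_im, abs_le] at this
      have ht2 : t ≤ z₀.im + r := ht.2
      exact ⟨by simp only; linarith, by simp only; linarith, hre z hz⟩
    · intro t ht
      refine DifferentiableOn.mul ?_ ?_
      · refine (h.diffF t (ht.2.trans h2.le)).comp (by fun_prop) ?_
        intro z hz
        have := (abs_im_le_norm (z - z₀)).trans_lt (by simpa [dist_eq_norm] using hz)
        rw [sub_im, abs_lt] at this
        have ht2 : t ≤ z₀.im := ht.2
        simp
        linarith
      · exact hk.comp (by fun_prop) (fun z hz => by
          simpa using hre z (ball_subset_closedBall hz))
  choose! L hL1 hL2 using hder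
  have hconj : ∀ z : ℂ, z - 2 * z.im * I = conj z := fun z => by
    apply Complex.ext <;> simp; ring
  have im_mem : ∀ z ∈ K, z.im ∈ Icc (-1) z.im := fun z hz => ⟨(hKs z hz).1.le, le_rfl⟩
  refine ⟨_, L, hL1, ?_, fun z hz => ⟨?_, ?_⟩⟩
  · refine ContinuousOn.congr (continuousOn_const.mul ?_) hL2
    refine cF.comp (f := fun z : ℂ => (z.im, z, δ)) (by fun_prop) ?_
    intro z hz
    exact ⟨(hKs z hz).2.1.le, by simp [hδ.le], (hKs z hz).2.2⟩
  · have hsec : ∀ d : ℝ, 0 ≤ d → IntervalIntegrable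
        (fun t : ℝ => F t (z + d * I) * k (z - 2 * t * I)) volume (-1) z.im := by
      intro d hd
      refine ContinuousOn.intervalIntegrable ?_
      refine cF.comp (f := fun t : ℝ => (t, z, d)) (by fun_prop) ?_
      intro t ht
      rw [uIcc_of_le (hKs z hz).1.le] at ht
      exact ⟨ht.2.trans (hKs z hz).2.1.le, by simp only; linarith [ht.2], (hKs z hz).2.2⟩
    have h0 := hsec 0 le_rfl
    simp only [ofReal_zero, zero_mul, add_zero] at h0
    rw [← intervalIntegral.integral_sub (hsec δ hδ.le) h0]
    have := intervalIntegral.norm_integral_le_of_norm_le_const (a := -1) (b := z.im)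
      (f := fun t => F t (z + δ * I) * k (z - 2 * t * I) - F t z * k (z - 2 * t * I)) (C := ε')
      (fun t ht => close z hz t (by
        rw [← uIcc_of_le (hKs z hz).1.le]; exact uIoc_subset_uIcc ht))
    refine this.trans ?_
    have h5 : |z.im - -1| ≤ |T + 1| := by
      rw [abs_of_nonneg (by linarith [(hKs z hz).1]), abs_of_nonneg (by
        linarith [(hKs z hz).1, (hKs z hz).2.1])]
      linarith [(hKs z hz).2.1]
    nlinarith
  · rw [hL2 z hz, ← mul_sub, norm_mul, norm_I, one_mul]
    have := close z hz _ (im_mem z hz)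
    rw [h.eqF _ (hKs z hz).2.1.le z rfl, hconj] at this
    rw [hconj]
    exact this.trans hε'2

/-! ### Jumps of Cauchy integrals across the imaginary axis. -/

theorem tendsto_poisson_integral {G : ℝ → ℂ} {p q τ : ℝ} (hpq : p ≤ q)
    (hG : ContinuousOn G (Icc p q)) (hτ : τ ∈ Ioo p q) :
    Tendsto (fun c : ℝ => ∫ t in p..q, G t * ((c / (1 + (c * (τ - t)) ^ 2) : ℝ) : ℂ))
      atTop (𝓝 (Real.pi * G τ)) := by
  -- Normalised, the kernel is an approximate identity. Cutting `G` off outside the interval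
  -- preserves continuity at the interior point τ.
  let φ : ℝ → ℝ := fun u => Real.pi⁻¹ * (1 + u ^ 2)⁻¹
  have h1 : ∀ u, 0 ≤ φ u := fun u => by positivity
  have h2 : ∫ u, φ u = 1 := by
    rw [integral_const_mul, integral_univ_inv_one_add_sq]
    exact inv_mul_cancel₀ Real.pi_ne_zero
  have h3 : Tendsto (fun u : ℝ => ‖u‖ ^ Module.finrank ℝ ℝ * φ u) (Bornology.cobounded ℝ)
      (𝓝 0) := by
    have hb : ∀ u : ℝ, ‖u‖ ^ Module.finrank ℝ ℝ * φ u ≤ Real.pi⁻¹ * ‖u‖⁻¹ := by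
      intro u
      simp only [Module.finrank_self, pow_one, φ]
      rw [mul_left_comm]
      refine mul_le_mul_of_nonneg_left ?_ (by positivity)
      rcases eq_or_ne u 0 with rfl | hu
      · simp
      have : 0 < ‖u‖ := norm_pos_iff.2 hu
      rw [← div_eq_mul_inv, div_le_iff₀ (by positivity), mul_add, mul_one]
      have h4 : ‖u‖⁻¹ * u ^ 2 = ‖u‖ := by
        rw [← sq_abs, ← Real.norm_eq_abs]; field_simp
      rw [h4]
      have : 0 < ‖u‖⁻¹ := by positivity
      linarith
    refine squeeze_zero (fun u => mul_nonneg (by positivity) (h1 u)) hb ?_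
    simpa using (tendsto_inv_atTop_zero.comp (tendsto_norm_cobounded_atTop (E := ℝ))).const_mul
      Real.pi⁻¹
  let g : ℝ → ℂ := indicator (Ioc p q) G
  have hgi : Integrable g := by
    refine IntegrableOn.integrable_indicator ?_ measurableSet_Ioc
    exact (hG.integrableOn_compact isCompact_Icc).mono_set Ioc_subset_Icc_self
  have hgc : ContinuousAt g τ := by
    refine ((hG.continuousAt (Icc_mem_nhds hτ.1 hτ.2))).congr ?_
    filter_upwards [Ioo_mem_nhds hτ.1 hτ.2] with t ht
    exact (indicator_of_mem (Ioo_subset_Ioc_self ht) G).symm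
  have h4 := (tendsto_integral_comp_smul_smul_of_integrable' (μ := volume) h1 h2 h3 hgi hgc).const_mul
    (Real.pi : ℂ)
  have h5 : g τ = G τ := indicator_of_mem (Ioo_subset_Ioc_self hτ) G
  rw [h5] at h4
  refine h4.congr fun c => ?_
  rw [intervalIntegral.integral_of_le hpq, ← integral_indicator measurableSet_Ioc,
    ← integral_const_mul]
  congr 1
  funext t
  by_cases ht : t ∈ Ioc p q
  · simp only [g, indicator_of_mem ht, φ, Module.finrank_self, pow_one, smul_eq_mul, real_smul]
    have : (Real.pi : ℂ) ≠ 0 := ofReal_ne_zero.2 Real.pi_ne_zero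
    push_cast
    field_simp
  · simp [g, indicator_of_notMem ht]

/-- No jump on the F₂ side: each factor has real part 1 - xσ ≥ m or 1 - x'σ ≥ m because |x|, |x'| ≤
(1 - m)y and |σ| ≤ 1/y, so the kernel changes only by O(η) when the parameters cross the axis. -/
theorem norm_inv_sub_inv_le {σ x x' η m y : ℝ} (hy : 0 < y) (hη : 0 ≤ η) (hm : 0 < m)
    (hx : m * y ≤ y - |x|) (hx' : m * y ≤ y - |x'|) (hσ : |σ| ≤ 1 / y) :
    ‖((1 + (-η + x * I) * (σ * I)) * (1 + (-η + x' * I) * (σ * I)))⁻¹ -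
      ((1 + (η + x * I) * (σ * I)) * (1 + (η + x' * I) * (σ * I)))⁻¹‖ ≤ 8 * η / (y * m ^ 4) := by
  have hσy : |σ| * y ≤ 1 := by rwa [le_div_iff₀ hy] at hσ
  have lower : ∀ x : ℝ, m * y ≤ y - |x| → ∀ e : ℝ, m ≤ ‖(1 + (e + x * I) * (σ * I) : ℂ)‖ := by
    intro x hx e
    refine le_trans ?_ (abs_re_le_norm _)
    have h1 : (1 + (e + x * I) * (σ * I) : ℂ).re = 1 - x * σ := by simp; ring
    rw [h1]
    refine le_trans ?_ (le_abs_self _)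
    have h2 : x * σ ≤ |x| * |σ| := (le_abs_self _).trans (abs_mul _ _).le
    have h3 : |x| ≤ y * (1 - m) := by linarith
    have h4 : |x| * |σ| ≤ y * (1 - m) * |σ| := mul_le_mul_of_nonneg_right h3 (abs_nonneg _)
    have h5 : 0 ≤ 1 - m := by
      by_contra h
      have := abs_nonneg x
      nlinarith
    nlinarith
  have l1 := lower x hx (-η)
  have l2 := lower x' hx' (-η)
  have l3 := lower x hx η
  have l4 := lower x' hx' η
  push_cast at l1 l2
  set A : ℂ := 1 + (-η + x * I) * (σ * I)
  set B : ℂ := 1 + (-η + x' * I) * (σ * I)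
  set A' : ℂ := 1 + (η + x * I) * (σ * I)
  set B' : ℂ := 1 + (η + x' * I) * (σ * I)
  have hA : 0 < ‖A‖ := hm.trans_le l1
  have hB : 0 < ‖B‖ := hm.trans_le l2
  have hA' : 0 < ‖A'‖ := hm.trans_le l3
  have hB' : 0 < ‖B'‖ := hm.trans_le l4
  rw [inv_sub_inv (mul_ne_zero (norm_pos_iff.1 hA) (norm_pos_iff.1 hB))
    (mul_ne_zero (norm_pos_iff.1 hA') (norm_pos_iff.1 hB')), norm_div]
  have hnum : A' * B' - A * B = (2 * η * σ : ℝ) * I * ((2 - (x + x') * σ : ℝ) : ℂ) := by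
    simp only [A, B, A', B']
    push_cast
    linear_combination (2 * η * σ ^ 2 * (x + x') * I : ℂ) * I_sq
  have hnn : ‖A' * B' - A * B‖ ≤ 8 * η / y := by
    rw [hnum, norm_mul, norm_mul, norm_I, norm_real, norm_real, Real.norm_eq_abs, Real.norm_eq_abs,
      abs_mul, abs_mul, abs_of_nonneg hη, abs_two, mul_one]
    have h1 : |2 - (x + x') * σ| ≤ 4 := by
      have e1 : |x * σ| ≤ 1 := by
        rw [abs_mul]
        nlinarith [abs_nonneg σ, abs_nonneg x, mul_pos hm hy]
      have e2 : |x' * σ| ≤ 1 := by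
        rw [abs_mul]
        nlinarith [abs_nonneg σ, abs_nonneg x', mul_pos hm hy]
      rw [abs_le] at *
      constructor <;> linarith
    calc 2 * η * |σ| * |2 - (x + x') * σ| ≤ 2 * η * (1 / y) * 4 := by gcongr
      _ = 8 * η / y := by ring
  rw [div_mul_eq_div_div]
  refine div_le_div₀ (by positivity) hnn (by positivity) ?_
  rw [norm_mul, norm_mul, norm_mul]
  calc m ^ 4 = (m * m) * (m * m) := by ring
    _ ≤ _ := by gcongr

/-- Jump of a simple Cauchy kernel between the points at distance 2/c on either side of the axis: a
Poisson kernel of width 1/c. -/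
theorem inv_sub_inv_eq_poisson {c u : ℝ} (hc : 0 < c) :
    (2 * u * I + 2 / c : ℂ)⁻¹ - (2 * u * I - 2 / c : ℂ)⁻¹ = ((c / (1 + (c * u) ^ 2) : ℝ) : ℂ) := by
  have hc' : (c : ℂ) ≠ 0 := ofReal_ne_zero.2 hc.ne'
  have h1 : (2 * u * I + 2 / c : ℂ) ≠ 0 := by
    intro h
    have := congrArg re h
    have e : (2 / c : ℂ) = ((2 / c : ℝ) : ℂ) := by push_cast; rfl
    rw [e] at this
    simp at this
    exact hc.ne' this
  have h2 : (2 * u * I - 2 / c : ℂ) ≠ 0 := by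
    intro h
    have := congrArg re h
    have e : (2 / c : ℂ) = ((2 / c : ℝ) : ℂ) := by push_cast; rfl
    rw [e] at this
    simp at this
    exact hc.ne' this
  have h3 : ((1 + (c * u) ^ 2 : ℝ) : ℂ) ≠ 0 := ofReal_ne_zero.2 (by positivity)
  rw [inv_sub_inv h1 h2, ofReal_div, div_eq_div_iff (mul_ne_zero h1 h2) h3]
  push_cast
  field_simp
  linear_combination (-2 * c ^ 2 * u ^ 2 : ℂ) * I_sq

/-- Multiplying by i(x - x') splits the double kernel into a difference of simple ones. As the poles
cross the axis the left side jumps by π(G τ - G τ'). On the right the poles in w tend to i/x and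
i/x', beyond the segment |Im w| ≤ 1/y since |x|, |x'| < y, so there is no jump. -/
theorem eq_of_integral_cauchy_kernel_eq {y C : ℝ} (hy : 0 < y) {G G₂ : ℝ → ℂ}
    (hG : ContinuousOn G (Icc (-1) y)) (hG₂ : ContinuousOn G₂ (Icc (-1) (1 / y)))
    (hC : ∀ t ∈ Icc (-1) (1 / y), ‖G₂ t‖ ≤ C) (hG₂0 : ∀ t ≤ 0, G₂ t = 0)
    (h : ∀ a b : ℂ, 0 < a.re * b.re →
      ∫ t in (-1 : ℝ)..y, G t * ((((y - 2 * t : ℝ) * I - a) * ((y - 2 * t : ℝ) * I - b))⁻¹) =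
      ∫ t in (-1 : ℝ)..(1 / y), G₂ t *
        (((1 + a * ((1 / y - 2 * t : ℝ) * I)) * (1 + b * ((1 / y - 2 * t : ℝ) * I)))⁻¹))
    {τ τ' : ℝ} (hτ : τ ∈ Ioo 0 y) (hτ' : τ' ∈ Ioo 0 y) : G τ = G τ' := by
  have hy1 : -1 ≤ y := by linarith
  have hy2 : -1 ≤ 1 / y := by have : 0 < 1 / y := by positivity
                              linarith
  have mem : ∀ τ ∈ Ioo 0 y, τ ∈ Ioo (-1) y := fun τ h => ⟨by linarith [h.1], h.2⟩
  have T1 := tendsto_poisson_integral hy1 hG (mem τ hτ)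
  have T2 := tendsto_poisson_integral hy1 hG (mem τ' hτ')
  have T3 := T1.sub T2
  have hC0 : 0 ≤ C := (norm_nonneg _).trans (hC (-1) ⟨le_rfl, hy2⟩)
  set x := y - 2 * τ with hx
  set x' := y - 2 * τ' with hx'
  obtain ⟨m, hm, hmx, hmx'⟩ : ∃ m > 0, m * y ≤ y - |x| ∧ m * y ≤ y - |x'| := by
    have e1 : |x| < y := abs_lt.2 ⟨by linarith [hτ.2], by linarith [hτ.1]⟩
    have e2 : |x'| < y := abs_lt.2 ⟨by linarith [hτ'.2], by linarith [hτ'.1]⟩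
    refine ⟨min (y - |x|) (y - |x'|) / y, div_pos (lt_min (by linarith) (by linarith)) hy, ?_, ?_⟩
    · rw [div_mul_cancel₀ _ hy.ne']; exact min_le_left _ _
    · rw [div_mul_cancel₀ _ hy.ne']; exact min_le_right _ _
  have key : ∀ c : ℝ, 0 < c →
      ‖(∫ t in (-1 : ℝ)..y, G t * ((c / (1 + (c * (τ - t)) ^ 2) : ℝ) : ℂ)) -
        ∫ t in (-1 : ℝ)..y, G t * ((c / (1 + (c * (τ' - t)) ^ 2) : ℝ) : ℂ)‖ ≤
      (‖((x - x' : ℝ) : ℂ) * I‖ * (C * (8 * 2 / (y * m ^ 4)) * |1 / y - -1|)) / c := by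
    intro c hc
    -- The points a, b lie at distance η to the left of the axis and a', b' to the right; x = y - 2τ
    -- puts the first pole opposite t = τ, and x' the second opposite τ'.
    set η : ℝ := 2 / c with hη
    have hη0 : 0 < η := by positivity
    set a : ℂ := -η + x * I with ha
    set b : ℂ := -η + x' * I with hb
    set a' : ℂ := η + x * I with ha'
    set b' : ℂ := η + x' * I with hb'
    have hab := h a b (by simp [ha, hb]; positivity)
    have hab' := h a' b' (by simp [ha', hb']; positivity)
    have nz : ∀ (s x η : ℝ), η ≠ 0 → ((s * I - (η + x * I) : ℂ)) ≠ 0 := by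
      intro s x η hη h0
      have := congrArg re h0
      simp at this
      exact hη this
    have nza : ∀ s : ℝ, (s * I - a : ℂ) ≠ 0 := fun s => by
      simpa [ha] using nz s x (-η) (by linarith)
    have nzb : ∀ s : ℝ, (s * I - b : ℂ) ≠ 0 := fun s => by
      simpa [hb] using nz s x' (-η) (by linarith)
    have nza' : ∀ s : ℝ, (s * I - a' : ℂ) ≠ 0 := fun s => nz s x η hη0.ne'
    have nzb' : ∀ s : ℝ, (s * I - b' : ℂ) ≠ 0 := fun s => nz s x' η hη0.ne'
    have ker : ∀ t : ℝ, G t * ((c / (1 + (c * (τ - t)) ^ 2) : ℝ) : ℂ) -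
        G t * ((c / (1 + (c * (τ' - t)) ^ 2) : ℝ) : ℂ) =
        (((x - x' : ℝ) : ℂ) * I) * (G t * ((((y - 2 * t : ℝ) * I - a) * ((y - 2 * t : ℝ) * I - b))⁻¹)
          - G t * ((((y - 2 * t : ℝ) * I - a') * ((y - 2 * t : ℝ) * I - b'))⁻¹)) := by
      intro t
      have e1 := inv_sub_inv_eq_poisson (u := τ - t) hc
      have e2 := inv_sub_inv_eq_poisson (u := τ' - t) hc
      have q1 : (2 * (τ - t : ℝ) * I + 2 / c : ℂ) = (y - 2 * t : ℝ) * I - a := by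
        simp only [ha, hx, hη]; push_cast; ring
      have q2 : (2 * (τ - t : ℝ) * I - 2 / c : ℂ) = (y - 2 * t : ℝ) * I - a' := by
        simp only [ha', hx, hη]; push_cast; ring
      have q3 : (2 * (τ' - t : ℝ) * I + 2 / c : ℂ) = (y - 2 * t : ℝ) * I - b := by
        simp only [hb, hx', hη]; push_cast; ring
      have q4 : (2 * (τ' - t : ℝ) * I - 2 / c : ℂ) = (y - 2 * t : ℝ) * I - b' := by
        simp only [hb', hx', hη]; push_cast; ring
      rw [q1, q2] at e1
      rw [q3, q4] at e2
      rw [← e1, ← e2]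
      set s : ℝ := y - 2 * t
      have r1 : ((x - x' : ℝ) : ℂ) * I = (s * I - b) - (s * I - a) := by
        simp only [ha, hb]; push_cast; ring
      have r2 : ((x - x' : ℝ) : ℂ) * I = (s * I - b') - (s * I - a') := by
        simp only [ha', hb']; push_cast; ring
      have v1 : ((x - x' : ℝ) : ℂ) * I * ((s * I - a) * (s * I - b))⁻¹ =
          (s * I - a)⁻¹ - (s * I - b)⁻¹ := by
        rw [r1, inv_sub_inv (nza s) (nzb s), div_eq_mul_inv]
      have v2 : ((x - x' : ℝ) : ℂ) * I * ((s * I - a') * (s * I - b'))⁻¹ =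
          (s * I - a')⁻¹ - (s * I - b')⁻¹ := by
        rw [r2, inv_sub_inv (nza' s) (nzb' s), div_eq_mul_inv]
      linear_combination (-G t) * v1 + G t * v2
    have iG : ∀ k : ℝ → ℂ, Continuous k →
        IntervalIntegrable (fun t => G t * k t) volume (-1) y := by
      intro k hk
      refine ContinuousOn.intervalIntegrable ?_
      rw [uIcc_of_le hy1]
      exact hG.mul hk.continuousOn
    have cP : ∀ τ : ℝ, Continuous fun t : ℝ => ((c / (1 + (c * (τ - t)) ^ 2) : ℝ) : ℂ) := by
      intro τ
      refine continuous_ofReal.comp (Continuous.div (by fun_prop) (by fun_prop) fun t => ?_)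
      positivity
    have cK : ∀ a b : ℂ, (∀ s : ℝ, (s * I - a : ℂ) ≠ 0) → (∀ s : ℝ, (s * I - b : ℂ) ≠ 0) →
        Continuous fun t : ℝ => (((y - 2 * t : ℝ) * I - a) * ((y - 2 * t : ℝ) * I - b))⁻¹ := by
      intro a b h1 h2
      exact Continuous.inv₀ (by fun_prop) fun t => mul_ne_zero (h1 _) (h2 _)
    rw [← intervalIntegral.integral_sub (iG _ (cP τ)) (iG _ (cP τ'))]
    simp only [ker]
    rw [intervalIntegral.integral_const_mul, norm_mul, mul_div_assoc,
      intervalIntegral.integral_sub (iG _ (cK a b nza nzb)) (iG _ (cK a' b' nza' nzb')), hab, hab']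
    refine mul_le_mul_of_nonneg_left ?_ (norm_nonneg _)
    have small : ∀ t ∈ Ι (-1) (1 / y), ‖G₂ t *
        (((1 + a * ((1 / y - 2 * t : ℝ) * I)) * (1 + b * ((1 / y - 2 * t : ℝ) * I)))⁻¹) - G₂ t *
        (((1 + a' * ((1 / y - 2 * t : ℝ) * I)) * (1 + b' * ((1 / y - 2 * t : ℝ) * I)))⁻¹)‖ ≤
        C * (8 * η / (y * m ^ 4)) := by
      intro t ht
      rw [uIoc_of_le hy2] at ht
      rcases le_or_gt t 0 with h0 | h0
      · rw [hG₂0 t h0, zero_mul, zero_mul, sub_zero, norm_zero]; positivity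
      rw [← mul_sub, norm_mul]
      refine mul_le_mul (hC t (Ioc_subset_Icc_self ht)) ?_ (norm_nonneg _) hC0
      refine norm_inv_sub_inv_le hy hη0.le hm hmx hmx' (abs_le.2 ⟨?_, ?_⟩)
      · linarith [ht.2]
      · linarith
    have iG₂ : ∀ x x' η : ℝ, (m * y ≤ y - |x|) → (m * y ≤ y - |x'|) → IntervalIntegrable (fun t => G₂ t *
        (((1 + (η + x * I) * ((1 / y - 2 * t : ℝ) * I)) *
          (1 + (η + x' * I) * ((1 / y - 2 * t : ℝ) * I)))⁻¹)) volume (-1) (1 / y) := by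
      intro x x' η h1 h2
      have h0 : (0 : ℝ) ≤ 1 / y := by positivity
      have nz : ∀ x : ℝ, m * y ≤ y - |x| → ∀ t ∈ Icc 0 (1 / y),
          (1 + (η + x * I) * ((1 / y - 2 * t : ℝ) * I) : ℂ) ≠ 0 := by
        intro x hx t ht h0
        have e := congrArg re h0
        have e2 : (1 + (η + x * I) * ((1 / y - 2 * t : ℝ) * I) : ℂ).re =
            1 - x * (1 / y - 2 * t) := by
          simp; ring
        rw [e2, zero_re] at e
        have h3 : |1 / y - 2 * t| * y ≤ 1 := by
          rw [← le_div_iff₀ hy, abs_le]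
          constructor <;> linarith [ht.1, ht.2]
        have h4 : x * (1 / y - 2 * t) ≤ |x| * |1 / y - 2 * t| :=
          (le_abs_self _).trans (abs_mul _ _).le
        have h6 : |x| < y := by nlinarith
        have h5 : (1 : ℝ) ≤ |x| * |1 / y - 2 * t| := by linarith
        have h7 : 0 < |1 / y - 2 * t| := by
          by_contra h
          have : |1 / y - 2 * t| = 0 := le_antisymm (not_lt.1 h) (abs_nonneg _)
          rw [this] at h5; linarith
        nlinarith
      -- For t < 0 the kernel may be singular, since 1/y - 2t exceeds 1/y; there `G₂` is zero.
      refine IntervalIntegrable.trans (b := 0) ?_ ?_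
      · refine (intervalIntegrable_const (c := (0 : ℂ))).congr ?_
        intro t ht
        rw [uIoc_of_le (by norm_num)] at ht
        simp [hG₂0 t ht.2]
      · refine ContinuousOn.intervalIntegrable ?_
        rw [uIcc_of_le h0]
        refine (hG₂.mono (Icc_subset_Icc_left (by norm_num))).mul (ContinuousOn.inv₀ (by fun_prop) ?_)
        exact fun t ht => mul_ne_zero (nz x h1 t ht) (nz x' h2 t ht)
    have i1 := iG₂ x x' (-η) hmx hmx'
    have i2 := iG₂ x x' η hmx hmx'
    simp only [ofReal_neg] at i1
    rw [← intervalIntegral.integral_sub i1 i2]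
    refine (intervalIntegral.norm_integral_le_of_norm_le_const small).trans (le_of_eq ?_)
    rw [hη]; ring
  obtain ⟨D, key⟩ : ∃ D : ℝ, ∀ c : ℝ, 0 < c →
      ‖(∫ t in (-1 : ℝ)..y, G t * ((c / (1 + (c * (τ - t)) ^ 2) : ℝ) : ℂ)) -
        ∫ t in (-1 : ℝ)..y, G t * ((c / (1 + (c * (τ' - t)) ^ 2) : ℝ) : ℂ)‖ ≤ D / c := ⟨_, key⟩
  have T4 : Tendsto (fun c : ℝ => (∫ t in (-1 : ℝ)..y, G t * ((c / (1 + (c * (τ - t)) ^ 2) : ℝ) : ℂ)) -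
        ∫ t in (-1 : ℝ)..y, G t * ((c / (1 + (c * (τ' - t)) ^ 2) : ℝ) : ℂ)) atTop (𝓝 0) := by
    refine squeeze_zero_norm' (a := fun c => D / c) ?_ (tendsto_const_nhds.div_atTop tendsto_id)
    filter_upwards [eventually_gt_atTop 0] with c hc using key c hc
  have T5 := tendsto_nhds_unique T3 T4
  rw [← mul_sub, mul_eq_zero] at T5
  rcases T5 with h | h
  · exact absurd (ofReal_eq_zero.1 h) Real.pi_ne_zero
  · exact sub_eq_zero.1 h

/-! ### The integral identity linking the two families. -/

theorem re_neg_inv (z : ℂ) : (-z⁻¹).re = -z.re / normSq z := by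
  rw [neg_re, inv_re, neg_div]

theorem im_neg_inv (z : ℂ) : (-z⁻¹).im = z.im / normSq z := by
  rw [neg_im, inv_im, neg_div, neg_neg]

/-- The symmetry z ↦ -z̄ swaps the right and left half-planes, reducing parameters with positive
real part to those with negative real part. -/
theorem HalfPlaneExt.reflect {f : ℂ → ℂ} {T : ℝ} {F : ℝ → ℂ → ℂ} (h : HalfPlaneExt f T F) :
    HalfPlaneExt (fun z => conj (f (-conj z))) T (fun t z => conj (F t (-conj z))) := by
  have hr : Continuous fun z : ℂ => -conj z := continuous_conj.neg
  have hrc : Tendsto (fun z : ℂ => -conj z) (cocompact ℂ) (cocompact ℂ) := by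
    rw [← cobounded_eq_cocompact, ← tendsto_norm_atTop_iff_cobounded]
    simpa using tendsto_norm_cobounded_atTop (E := ℂ)
  have hc0 : Tendsto (fun z : ℂ => conj z) (𝓝 0) (𝓝 0) := by
    simpa using continuous_conj.tendsto (0 : ℂ)
  refine ⟨continuous_conj.comp (h.cont.comp hr), hc0.comp (h.tendsto.comp hrc), ?_, ?_, ?_, ?_, ?_⟩
  · intro t ht z
    simp [h.eq_zero t ht]
  · intro t ht
    exact continuous_conj.comp_continuousOn
      ((h.contF t ht).comp hr.continuousOn fun z hz => by simpa using hz)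
  · intro t ht z hz
    have h1 : DifferentiableAt ℂ (fun w => F t (-w)) (conj z) := by
      refine DifferentiableAt.comp (conj z) (f := fun w : ℂ => -w) ?_ differentiableAt_id.neg
      refine (h.diffF t ht).differentiableAt ((isOpen_lt continuous_const continuous_im).mem_nhds ?_)
      simpa using hz
    have h2 := h1.conj_conj
    rw [conj_conj] at h2
    exact h2.differentiableWithinAt
  · intro t ht
    refine hc0.comp ((h.tendstoF t ht).comp (tendsto_inf.2 ⟨hrc.mono_left inf_le_left, ?_⟩))
    refine tendsto_principal.2 ?_
    rw [eventually_inf_principal]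
    exact Eventually.of_forall fun z hz => by simpa using hz
  · intro t ht z hz
    rw [h.eqF t ht _ (by simpa using hz)]

theorem integral_cauchy_kernel_eq_of_re_neg {f₁ f₂ : ℂ → ℂ} {T₁ T₂ : ℝ} {F₁ F₂ : ℝ → ℂ → ℂ}
    (h₁ : HalfPlaneExt f₁ T₁ F₁) (h₂ : HalfPlaneExt f₂ T₂ F₂) (hT₁ : 0 < T₁) (hT₂ : 0 < T₂)
    (hf : ∀ z ≠ 0, f₂ (-z⁻¹) = f₁ z) {a b : ℂ} (ha : a.re < 0) (hb : b.re < 0) {y : ℝ}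
    (hy : y ∈ Ioo (1 / T₂) T₁) :
    ∫ t in (-1 : ℝ)..y, F₁ t (y * I) *
        ((((y - 2 * t : ℝ) * I - a) * ((y - 2 * t : ℝ) * I - b))⁻¹) =
      ∫ t in (-1 : ℝ)..(1 / y), F₂ t ((1 / y : ℝ) * I) *
        (((1 + a * ((1 / y - 2 * t : ℝ) * I)) * (1 + b * ((1 / y - 2 * t : ℝ) * I)))⁻¹) := by
  have hT₂' : 0 < 1 / T₂ := by positivity
  have hy0 : 0 < y := hT₂'.trans hy.1
  have ha0 : a ≠ 0 := fun h => by simp [h] at ha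
  have hb0 : b ≠ 0 := fun h => by simp [h] at hb
  set α := max a.re b.re with hα
  have hα0 : α < 0 := max_lt ha hb
  set β := min (-a⁻¹).re (-b⁻¹).re with hβ
  have hβ0 : 0 < β := by
    refine lt_min ?_ ?_
    · rw [re_neg_inv]; exact div_pos (by linarith) (normSq_pos.2 ha0)
    · rw [re_neg_inv]; exact div_pos (by linarith) (normSq_pos.2 hb0)
  -- Two factors make `k` decay to second order, so its transform `k₂` has no pole at w = 0:
  -- conj(z⁻²) k₂(-1/z̄) = k(z̄).
  let k : ℂ → ℂ := fun w => ((w - a) * (w - b))⁻¹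
  let k₂ : ℂ → ℂ := fun w => ((1 + a * w) * (1 + b * w))⁻¹
  have hk : DifferentiableOn ℂ k {w | w.re ∈ Ioi α} := by
    refine DifferentiableOn.inv (by fun_prop) fun w hw => mul_ne_zero ?_ ?_
    · intro h
      rw [sub_eq_zero.1 h] at hw
      exact absurd (le_max_left a.re b.re) (not_le.2 hw)
    · intro h
      rw [sub_eq_zero.1 h] at hw
      exact absurd (le_max_right a.re b.re) (not_le.2 hw)
  have nz : ∀ a w : ℂ, a ≠ 0 → w.re < (-a⁻¹).re → 1 + a * w ≠ 0 := by
    intro a w ha hw h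
    have : w = -a⁻¹ := by
      field_simp
      linear_combination h
    rw [this] at hw
    exact lt_irrefl _ hw
  have hk₂ : DifferentiableOn ℂ k₂ {w | w.re ∈ Iio β} := by
    refine DifferentiableOn.inv (by fun_prop) fun w hw => mul_ne_zero ?_ ?_
    · exact nz a w ha0 (lt_of_lt_of_le hw (min_le_left _ _))
    · exact nz b w hb0 (lt_of_lt_of_le hw (min_le_right _ _))
  let Ψ₁ : ℂ → ℂ := fun z => ∫ t in (-1 : ℝ)..z.im, F₁ t z * k (z - 2 * t * I)
  let Ψ₂ : ℂ → ℂ := fun z => ∫ t in (-1 : ℝ)..z.im, F₂ t z * k₂ (z - 2 * t * I)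
  let Φ : ℂ → ℂ := fun z => Ψ₁ z - Ψ₂ (-z⁻¹)
  let A : Set ℂ := {z | -1 < z.im ∧ z.im < T₁ ∧ z.re ∈ Ioi α}
  let A₂ : Set ℂ := {z | -1 < z.im ∧ z.im < T₂ ∧ z.re ∈ Iio β}
  have hA : IsOpen A := (isOpen_lt continuous_const continuous_im).inter
    ((isOpen_lt continuous_im continuous_const).inter (isOpen_lt continuous_const continuous_re))
  have hA₂ : IsOpen A₂ := (isOpen_lt continuous_const continuous_im).inter
    ((isOpen_lt continuous_im continuous_const).inter (isOpen_lt continuous_re continuous_const))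
  have hinv : ContinuousOn (fun z : ℂ => -z⁻¹) {0}ᶜ := continuousOn_inv₀.neg
  let Ω : Set ℂ := A ∩ ({0}ᶜ ∩ (fun z : ℂ => -z⁻¹) ⁻¹' A₂)
  have hΩ : IsOpen Ω := hA.inter (hinv.isOpen_inter_preimage isOpen_compl_singleton hA₂)
  have hΦ : DifferentiableOn ℂ Φ Ω := by
    refine ApproxDbar.differentiableOn (g := fun z => I * (f₁ z * k (conj z)) -
      conj ((z ^ 2)⁻¹) * (I * (f₂ (-z⁻¹) * k₂ (conj (-z⁻¹))))) hΩ ?_ ?_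
    · rintro z ⟨⟨-, -, hz1⟩, hz0, -, -, hz2⟩
      rw [hf z hz0]
      have hc0 : conj z ≠ 0 := (map_ne_zero _).2 hz0
      have e1 : conj z - a ≠ 0 := by
        intro h
        have := congrArg re h
        simp at this
        have := le_max_left a.re b.re
        have : α < z.re := hz1
        linarith
      have e2 : conj z - b ≠ 0 := by
        intro h
        have := congrArg re h
        simp at this
        have := le_max_right a.re b.re
        have : α < z.re := hz1
        linarith
      simp only [k, k₂, map_inv₀, map_pow, map_neg]
      have e3 : 1 + a * -(conj z)⁻¹ = (conj z - a) / conj z := by field_simp; ring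
      have e4 : 1 + b * -(conj z)⁻¹ = (conj z - b) / conj z := by field_simp; ring
      rw [e3, e4]
      field_simp
      ring
    · intro K hK hKc
      refine (h₁.approxDbar isOpen_Ioi hk hKc fun z hz => (hK hz).1).sub ?_
      have hcK : ContinuousOn (fun z : ℂ => -z⁻¹) K := hinv.mono fun z hz => (hK hz).2.1
      refine (h₂.approxDbar isOpen_Iio hk₂ (hKc.image_of_continuousOn hcK) ?_).comp
        (φ := fun z => -z⁻¹) (φ' := fun z => (z ^ 2)⁻¹) hKc ?_ ?_ (mapsTo_image _ _)
      · rintro _ ⟨z, hz, rfl⟩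
        exact (hK hz).2.2
      · intro z hz
        have := (hasDerivAt_inv (hK hz).2.1).neg
        rw [neg_neg] at this
        exact this
      · exact ContinuousOn.inv₀ (by fun_prop) fun z hz => pow_ne_zero 2 (hK hz).2.1
  -- The condition Im(-1/z) < T₂ excludes a closed disc of radius 1/(2T₂) tangent to the real axis
  -- at 0. Beyond Re z = X one is to the right of it and has |z| > 1, hence Im(-1/z) > -1. `V₁` lies
  -- above the disc, `V₂` to its right and reaching below the real axis.
  set X : ℝ := 1 + 1 / (2 * T₂) with hX
  let V₁ : Set ℂ := Ioi 0 ×ℂ Ioo (1 / T₂) T₁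
  let V₂ : Set ℂ := Ioi X ×ℂ Ioo (-1) T₁
  have hX1 : 1 < X := by rw [hX]; linarith [show 0 < 1 / (2 * T₂) by positivity]
  have nsq : ∀ z : ℂ, normSq z = z.re ^ 2 + z.im ^ 2 := fun z => by rw [normSq_apply]; ring
  have hV₁ : V₁ ⊆ Ω := by
    rintro z ⟨hz1, hz2⟩
    have hx : 0 < z.re := hz1
    have hyy : 0 < z.im := hT₂'.trans hz2.1
    have hz0 : z ≠ 0 := fun h => by simp [h] at hx
    have hn : 0 < normSq z := normSq_pos.2 hz0
    refine ⟨⟨by linarith, hz2.2, hα0.trans hx⟩, hz0, ?_, ?_, ?_⟩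
    · rw [im_neg_inv]; have : 0 < z.im / normSq z := by positivity
      linarith
    · rw [im_neg_inv, div_lt_iff₀ hn, nsq]
      have := (div_lt_iff₀ hT₂).1 hz2.1
      have : 0 < T₂ * z.re ^ 2 := by positivity
      nlinarith
    · change (-z⁻¹).re < β
      rw [re_neg_inv]
      have : 0 < z.re / normSq z := by positivity
      rw [neg_div]; linarith
  have hV₂ : V₂ ⊆ Ω := by
    rintro z ⟨hz1, hz2⟩
    have hx : X < z.re := hz1
    have hx0 : 0 < z.re := by linarith
    have hz0 : z ≠ 0 := fun h => by simp [h] at hx0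
    have hn : 0 < normSq z := normSq_pos.2 hz0
    have hn1 : 1 < normSq z := by rw [nsq]; nlinarith
    refine ⟨⟨hz2.1, hz2.2, hα0.trans hx0⟩, hz0, ?_, ?_, ?_⟩
    · rw [im_neg_inv, lt_div_iff₀ hn]
      linarith [hz2.1]
    · rw [im_neg_inv, div_lt_iff₀ hn, nsq]
      have h1 : 1 / (2 * T₂) < z.re := by linarith
      have h2 : 1 < z.re * (2 * T₂) := (div_lt_iff₀ (by positivity)).1 h1
      by_contra h
      have h3 := not_lt.1 h
      nlinarith [sq_nonneg (2 * T₂ * z.im - 1), mul_le_mul_of_nonneg_left h3 hT₂.le]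
    · change (-z⁻¹).re < β
      rw [re_neg_inv]
      have : 0 < z.re / normSq z := by positivity
      rw [neg_div]; linarith
  have hconv : ∀ {s t : Set ℝ}, Convex ℝ s → Convex ℝ t → Convex ℝ (s ×ℂ t) := fun hs ht =>
    (hs.linear_preimage reLm).inter (ht.linear_preimage imLm)
  have hpre : IsPreconnected (V₁ ∪ V₂) := by
    obtain ⟨s, hs⟩ := nonempty_Ioo.2 (hy.1.trans hy.2)
    refine IsPreconnected.union (⟨X + 1, s⟩ : ℂ) ?_ ?_ ?_ ?_
    · exact ⟨show (0 : ℝ) < X + 1 by linarith, hs⟩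
    · exact ⟨show X < X + 1 by linarith, ⟨show -1 < s by linarith [hs.1], hs.2⟩⟩
    · exact (hconv (convex_Ioi 0) (convex_Ioo _ _)).isPreconnected
    · exact (hconv (convex_Ioi X) (convex_Ioo _ _)).isPreconnected
  have hopen : IsOpen (V₁ ∪ V₂) :=
    (isOpen_Ioi.reProdIm isOpen_Ioo).union (isOpen_Ioi.reProdIm isOpen_Ioo)
  have hsub : V₁ ∪ V₂ ⊆ Ω := union_subset hV₁ hV₂
  -- Inversion preserves the sign of the imaginary part, so both integrals run only over t ≤ 0,
  -- where the extensions vanish. Starting them at -1 leaves an open set for the identity theorem.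
  have hzero : ∀ z : ℂ, z.im < 0 → Φ z = 0 := by
    intro z hz
    have aux : ∀ {f F T} (_ : HalfPlaneExt f T F) (k : ℂ → ℂ) (z : ℂ), z.im ≤ 0 →
        ∫ t in (-1 : ℝ)..z.im, F t z * k (z - 2 * t * I) = 0 := by
      intro f F T h k z hz
      refine intervalIntegral.integral_zero_ae (Eventually.of_forall fun t ht => ?_)
      rw [h.eq_zero t ?_ z, zero_mul]
      rw [uIoc, mem_Ioc] at ht
      exact ht.2.trans (max_le (by norm_num) hz)
    simp only [Φ, Ψ₁, Ψ₂]
    rw [aux h₁ k z hz.le, aux h₂ k₂, sub_zero]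
    rw [im_neg_inv]
    exact div_nonpos_of_nonpos_of_nonneg hz.le (normSq_nonneg _)
  have hΦV : EqOn Φ 0 (V₁ ∪ V₂) := by
    refine ((hΦ.mono hsub).analyticOnNhd hopen).eqOn_zero_of_preconnected_of_eventuallyEq_zero hpre
      (z₀ := ⟨X + 1, -1 / 2⟩) (Or.inr ⟨show X < X + 1 by linarith, ?_⟩) ?_
    · exact ⟨show (-1 : ℝ) < -1 / 2 by norm_num, show (-1 / 2 : ℝ) < T₁ by linarith⟩
    · filter_upwards [(isOpen_lt continuous_im continuous_const).mem_nhds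
        (show (⟨X + 1, -1 / 2⟩ : ℂ).im < 0 by norm_num)] with z hz using hzero z hz
  have hinvy : -(y * I : ℂ)⁻¹ = (1 / y : ℝ) * I := by
    have : (y : ℂ) ≠ 0 := ofReal_ne_zero.2 hy0.ne'
    push_cast
    field_simp
    linear_combination -I_sq
  have him : ∀ s : ℝ, (s * I : ℂ).im = s := fun s => by simp
  have hyΩ : (y * I : ℂ) ∈ Ω := by
    refine ⟨⟨by simp; linarith, by simpa using hy.2, by simpa using hα0⟩, ?_, ?_⟩
    · simpa using hy0.ne'
    · change -(y * I : ℂ)⁻¹ ∈ A₂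
      rw [hinvy]
      refine ⟨?_, ?_, ?_⟩
      · have : 0 < 1 / y := by positivity
        rw [him]; linarith
      · rw [him]
        exact (one_div_lt hy0 hT₂).2 hy.1
      · simpa using hβ0
  -- The point iy lies on the edge of `V₁` but inside `Ω`, so continuity gives the value.
  have hval : Φ (y * I) = 0 := by
    have hc : ContinuousAt Φ (y * I) := (hΦ.differentiableAt (hΩ.mem_nhds hyΩ)).continuousAt
    have ht : Tendsto (fun s : ℝ => (s + y * I : ℂ)) (𝓝[>] 0) (𝓝 (y * I)) := by
      have : Continuous fun s : ℝ => (s + y * I : ℂ) := by fun_prop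
      have := (this.tendsto 0).mono_left (nhdsWithin_le_nhds (s := Ioi 0))
      simpa using this
    refine tendsto_nhds_unique (hc.tendsto.comp ht) ?_
    refine tendsto_const_nhds.congr' ?_
    filter_upwards [self_mem_nhdsWithin] with s hs
    refine (hΦV (Or.inl ⟨?_, ?_⟩)).symm
    · simpa using hs
    · simpa using hy
  simp only [Φ, Ψ₁, Ψ₂, hinvy] at hval
  rw [him, him, sub_eq_zero] at hval
  have harg : ∀ s t : ℝ, (s * I - 2 * t * I : ℂ) = (s - 2 * t : ℝ) * I := fun s t => by
    push_cast; ring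
  simp only [harg] at hval
  exact hval

theorem integral_cauchy_kernel_eq {f₁ f₂ : ℂ → ℂ} {T₁ T₂ : ℝ} {F₁ F₂ : ℝ → ℂ → ℂ}
    (h₁ : HalfPlaneExt f₁ T₁ F₁) (h₂ : HalfPlaneExt f₂ T₂ F₂) (hT₁ : 0 < T₁) (hT₂ : 0 < T₂)
    (hf : ∀ z ≠ 0, f₂ (-z⁻¹) = f₁ z) {a b : ℂ} (hab : 0 < a.re * b.re) {y : ℝ}
    (hy : y ∈ Ioo (1 / T₂) T₁) :
    ∫ t in (-1 : ℝ)..y, F₁ t (y * I) *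
        ((((y - 2 * t : ℝ) * I - a) * ((y - 2 * t : ℝ) * I - b))⁻¹) =
      ∫ t in (-1 : ℝ)..(1 / y), F₂ t ((1 / y : ℝ) * I) *
        (((1 + a * ((1 / y - 2 * t : ℝ) * I)) * (1 + b * ((1 / y - 2 * t : ℝ) * I)))⁻¹) := by
  rcases mul_pos_iff.1 hab with ⟨ha, hb⟩ | ⟨ha, hb⟩
  · have key := integral_cauchy_kernel_eq_of_re_neg h₁.reflect h₂.reflect hT₁ hT₂
      (a := -conj a) (b := -conj b)
      (fun z hz => by
        rw [← hf (-conj z) (by simpa using hz)]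
        simp) (by simpa using ha) (by simpa using hb) hy
    have iconj : ∀ (u : ℝ → ℂ) (p q : ℝ), ∫ t in p..q, conj (u t) = conj (∫ t in p..q, u t) := by
      intro u p q
      simp only [intervalIntegral, integral_conj, map_sub]
    have key' := congrArg conj key
    rw [← iconj, ← iconj] at key'
    refine Eq.trans ?_ (key'.trans ?_)
    · congr 1
      funext t
      simp only [map_mul, map_inv₀, map_sub, map_neg, conj_conj, conj_ofReal, conj_I, mul_neg,
        neg_neg]
      congr 2
      ring
    · congr 1
      funext t
      simp only [map_mul, map_inv₀, map_add, map_one, map_neg, conj_conj, conj_ofReal, conj_I,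
        mul_neg, neg_mul, neg_neg]
  · exact integral_cauchy_kernel_eq_of_re_neg h₁ h₂ hT₁ hT₂ hf ha hb hy

/-! ### Vanishing in the half-plane model. -/

theorem HalfPlaneExt.eq_zero_of_im_lt {f₁ f₂ : ℂ → ℂ} {T₁ T₂ : ℝ} {F₁ F₂ : ℝ → ℂ → ℂ}
    (h₁ : HalfPlaneExt f₁ T₁ F₁) (h₂ : HalfPlaneExt f₂ T₂ F₂) (hT₁ : 0 < T₁) (hT₂ : 0 < T₂)
    (hf : ∀ z ≠ 0, f₂ (-z⁻¹) = f₁ z) (hT : 1 < T₁ * T₂) {z : ℂ} (hz : z.im < T₁) : f₁ z = 0 := by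
  have hTT : 1 / T₂ < T₁ := (div_lt_iff₀ hT₂).2 hT
  have hT₂' : 0 < 1 / T₂ := by positivity
  have sec : ∀ {f T F} (_ : HalfPlaneExt f T F) {y : ℝ}, y ≤ T →
      ContinuousOn (fun t : ℝ => F t (y * I)) (Iic y) := by
    intro f T F h y hy
    exact h.continuousOn_uncurry.comp (f := fun t : ℝ => (t, (y * I : ℂ))) (by fun_prop)
      (fun t ht => ⟨le_trans ht hy, by simpa using ht⟩)
  have onAxis : ∀ y ∈ Ioo (1 / T₂) T₁, ∀ t < y, F₁ t (y * I) = 0 := by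
    intro y hy
    have hy0 : 0 < y := hT₂'.trans hy.1
    have hy2 : 1 / y ≤ T₂ := ((one_div_lt hy0 hT₂).2 hy.1).le
    have hG := sec h₁ hy.2.le
    have hG₂ := (sec h₂ hy2).mono (Icc_subset_Iic_self (a := -1))
    obtain ⟨C, hC⟩ := isCompact_Icc.exists_bound_of_continuousOn hG₂
    have hconst : ∀ τ ∈ Ioo 0 y, ∀ τ' ∈ Ioo 0 y, F₁ τ (y * I) = F₁ τ' (y * I) := by
      intro τ hτ τ' hτ'
      exact eq_of_integral_cauchy_kernel_eq (G := fun t => F₁ t (y * I))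
        (G₂ := fun t => F₂ t ((1 / y : ℝ) * I)) hy0 (hG.mono Icc_subset_Iic_self) hG₂ hC
        (fun t ht => h₂.eq_zero t ht _)
        (fun a b hab => integral_cauchy_kernel_eq h₁ h₂ hT₁ hT₂ hf hab hy) hτ hτ'
    intro t hty
    rcases le_or_gt t 0 with ht | ht
    · exact h₁.eq_zero t ht _
    -- The constant value on 0 < t < y is the limit as t decreases to 0, and the extension at t = 0
    -- is zero.
    have hc : ContinuousAt (fun t : ℝ => F₁ t (y * I)) 0 := hG.continuousAt (Iic_mem_nhds hy0)
    have h3 := hc.tendsto.mono_left (nhdsWithin_le_nhds (s := Ioi 0))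
    rw [h₁.eq_zero 0 le_rfl] at h3
    refine tendsto_nhds_unique ?_ h3
    refine tendsto_const_nhds.congr' ?_
    filter_upwards [Ioo_mem_nhdsGT hy0] with τ hτ using hconst t ⟨ht, hty⟩ τ hτ
  set t := z.im with ht
  -- F₁ t vanishes on a segment of the imaginary axis above height max t (1/T₂), hence on the whole
  -- open half-plane.
  have hup : ∀ w : ℂ, t < w.im → F₁ t w = 0 := by
    have hopen : IsOpen {w : ℂ | t < w.im} := isOpen_lt continuous_const continuous_im
    have hconv : Convex ℝ {w : ℂ | t < w.im} := convex_halfSpace_im_gt t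
    obtain ⟨y, hy⟩ := nonempty_Ioo.2 (max_lt hz hTT)
    have hyt : t < y := (le_max_left _ _).trans_lt hy.1
    have hEq := ((h₁.diffF t hz.le).analyticOnNhd hopen).eqOn_zero_of_preconnected_of_frequently_eq_zero
      hconv.isPreconnected (z₀ := y * I) (by simpa using hyt) ?_
    · exact fun w hw => hEq hw
    have hlim : Tendsto (fun s : ℝ => (s * I : ℂ)) (𝓝[>] y) (𝓝[≠] (y * I)) := by
      refine tendsto_nhdsWithin_iff.2 ⟨?_, ?_⟩
      · exact ((by fun_prop : Continuous fun s : ℝ => (s * I : ℂ)).tendsto y).mono_left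
          nhdsWithin_le_nhds
      · filter_upwards [self_mem_nhdsWithin] with s hs
        simpa using (ne_of_gt hs : s ≠ y)
    refine hlim.frequently (Eventually.frequently ?_)
    filter_upwards [Ioo_mem_nhdsGT hy.2] with s hs
    exact onAxis s ⟨((le_max_right _ _).trans_lt hy.1).trans hs.1, hs.2⟩ t (hyt.trans hs.1)
  rw [← h₁.eqF t hz.le z rfl]
  have hc := h₁.contF t hz.le z (show z ∈ {w : ℂ | t ≤ w.im} from ht.le)
  have hlim : Tendsto (fun s : ℝ => z + s * I) (𝓝[>] 0) (𝓝[{w | t ≤ w.im}] z) := by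
    refine tendsto_nhdsWithin_iff.2 ⟨?_, ?_⟩
    · have := ((by fun_prop : Continuous fun s : ℝ => z + s * I).tendsto 0).mono_left
        (nhdsWithin_le_nhds (s := Ioi 0))
      simpa using this
    · filter_upwards [self_mem_nhdsWithin] with s hs
      have : 0 < s := hs
      simp [← ht, this.le]
  refine tendsto_nhds_unique (hc.tendsto.comp hlim) (tendsto_const_nhds.congr' ?_)
  filter_upwards [self_mem_nhdsWithin] with s hs
  refine (hup _ ?_).symm
  have : 0 < s := hs
  simp [← ht, this]

/-- If Im z ≥ T₁ then Im(-1/z) ≤ 1/T₁ < T₂, so every point is low enough in one of the two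
coordinates. -/
theorem HalfPlaneExt.eq_zero_of_neg_inv {f₁ f₂ : ℂ → ℂ} {T₁ T₂ : ℝ} {F₁ F₂ : ℝ → ℂ → ℂ}
    (h₁ : HalfPlaneExt f₁ T₁ F₁) (h₂ : HalfPlaneExt f₂ T₂ F₂) (hT₁ : 0 < T₁) (hT₂ : 0 < T₂)
    (hf : ∀ z ≠ 0, f₂ (-z⁻¹) = f₁ z) (hT : 1 < T₁ * T₂) (z : ℂ) : f₁ z = 0 := by
  rcases lt_or_ge z.im T₁ with h | h
  · exact h₁.eq_zero_of_im_lt h₂ hT₁ hT₂ hf hT h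
  have hz : 0 < z.im := hT₁.trans_le h
  have hz0 : z ≠ 0 := fun h => by simp [h] at hz
  rw [← hf z hz0]
  refine h₂.eq_zero_of_im_lt h₁ hT₂ hT₁ (fun w hw => ?_) (by rwa [mul_comm]) ?_
  · rw [← hf (-w⁻¹) (by simpa using hw)]
    simp
  · have hn : 0 < normSq z := normSq_pos.2 hz0
    rw [im_neg_inv, div_lt_iff₀ hn, normSq_apply]
    have h1 : 1 < T₂ * z.im := by nlinarith
    nlinarith [mul_self_nonneg z.re]

/-! ### Transfer between the disc and the half-plane. -/

/-- For `‖p‖ = 1` and `κ` in the lower half-plane, the Möbius map that sends the upper half-plane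
to the unit disc and `∞` to `p`. -/
noncomputable def halfPlaneToDisc (p κ z : ℂ) : ℂ := p * ((z - conj κ) / (z - κ))

/-- The pullback of a function on the closed disc to the closed upper half-plane,
extended by zero. -/
noncomputable def halfPlanePullback (p κ : ℂ) (u : ℂ → ℂ) (z : ℂ) : ℂ :=
  if 0 ≤ z.im then u (halfPlaneToDisc p κ z) else 0

section HalfPlaneToDisc

variable {p κ : ℂ} {u : ℂ → ℂ}

theorem sub_ne_zero_of_im_nonneg (hκ : κ.im < 0) {z : ℂ} (hz : 0 ≤ z.im) : z - κ ≠ 0 := by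
  intro h
  rw [sub_eq_zero.1 h] at hz
  exact absurd hκ (not_lt.2 hz)

/-- The line Im z = t goes to the circle of radius ρ = m/(m + t) through p, where m = -Im κ. As an
exact identity, the sign of t - Im z decides between inside, on and outside. -/
theorem norm_halfPlaneToDisc_sub_sq (hp : ‖p‖ = 1) (hκ : κ.im < 0) {z : ℂ} (hz : z - κ ≠ 0)
    {t : ℝ} (ht : 0 ≤ t) :
    ‖halfPlaneToDisc p κ z - (1 - (-κ.im / (-κ.im + t) : ℝ)) * p‖ ^ 2 =
      (-κ.im / (-κ.im + t)) ^ 2 +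
        4 * -κ.im * (-κ.im / (-κ.im + t)) / normSq (z - κ) * (t - z.im) := by
  set ρ : ℝ := -κ.im / (-κ.im + t) with hρ
  have hρt : ρ * (-κ.im + t) = -κ.im := by
    rw [hρ]; field_simp [(by linarith : -κ.im + t ≠ 0)]
  have hn : normSq (z - κ) ≠ 0 := (normSq_pos.2 hz).ne'
  have e1 : halfPlaneToDisc p κ z - (1 - (ρ : ℂ)) * p =
      p * ((ρ * (z - κ) + (κ - conj κ)) / (z - κ)) := by
    rw [halfPlaneToDisc]
    field_simp
    ring
  rw [e1, norm_mul, hp, one_mul, norm_div, div_pow, ← normSq_eq_norm_sq, ← normSq_eq_norm_sq]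
  have e2 : normSq (ρ * (z - κ) + (κ - conj κ)) =
      ρ ^ 2 * normSq (z - κ) + 4 * -κ.im * ρ * (t - z.im) := by
    simp only [normSq_apply, add_re, add_im, sub_re, sub_im, re_ofReal_mul, im_ofReal_mul, conj_re,
      conj_im]
    linear_combination (-4 * κ.im) * (-hρt)
  rw [e2]
  field_simp

theorem norm_halfPlaneToDisc_sq (hp : ‖p‖ = 1) (hκ : κ.im < 0) {z : ℂ} (hz : z - κ ≠ 0) :
    ‖halfPlaneToDisc p κ z‖ ^ 2 = 1 - 4 * -κ.im / normSq (z - κ) * z.im := by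
  have := norm_halfPlaneToDisc_sub_sq hp hκ hz le_rfl
  rw [add_zero, div_self (by linarith)] at this
  simp only [ofReal_one, sub_self, zero_mul, sub_zero] at this
  rw [this]
  ring

theorem halfPlaneToDisc_mem_closedBall_zero (hp : ‖p‖ = 1) (hκ : κ.im < 0) {z : ℂ}
    (hz : 0 ≤ z.im) : halfPlaneToDisc p κ z ∈ closedBall (0 : ℂ) 1 := by
  have h := norm_halfPlaneToDisc_sq hp hκ (sub_ne_zero_of_im_nonneg hκ hz)
  have hn := normSq_pos.2 (sub_ne_zero_of_im_nonneg hκ hz)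
  have hk : 0 < -κ.im := by linarith
  have : 0 ≤ 4 * -κ.im / normSq (z - κ) * z.im := by positivity
  rw [mem_closedBall_zero_iff]
  nlinarith [norm_nonneg (halfPlaneToDisc p κ z)]

theorem norm_halfPlaneToDisc_of_im_eq_zero (hp : ‖p‖ = 1) (hκ : κ.im < 0) {z : ℂ}
    (hz : z.im = 0) : ‖halfPlaneToDisc p κ z‖ = 1 := by
  have h := norm_halfPlaneToDisc_sq hp hκ (sub_ne_zero_of_im_nonneg hκ hz.ge)
  rw [hz, mul_zero, sub_zero] at h
  exact (pow_eq_one_iff_of_nonneg (norm_nonneg _) two_ne_zero).1 h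

theorem tendsto_halfPlaneToDisc : Tendsto (halfPlaneToDisc p κ) (cocompact ℂ) (𝓝 p) := by
  have h1 : Tendsto (fun z : ℂ => z - κ) (cocompact ℂ) (cocompact ℂ) := by
    simpa [sub_eq_add_neg] using (Homeomorph.addRight (-κ)).isClosedEmbedding.tendsto_cocompact
  have h2 : Tendsto (fun z : ℂ => (z - κ)⁻¹) (cocompact ℂ) (𝓝 0) := tendsto_inv₀_cobounded.comp
    (by rwa [← cobounded_eq_cocompact] at h1 ⊢)
  have h3 : Tendsto (fun z : ℂ => p * (1 + (κ - conj κ) * (z - κ)⁻¹)) (cocompact ℂ) (𝓝 p) := by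
    simpa using ((h2.const_mul (κ - conj κ)).const_add 1).const_mul p
  refine h3.congr' ?_
  have h4 : ∀ᶠ z in cocompact ℂ, z ∈ ({κ} : Set ℂ)ᶜ := isCompact_singleton.compl_mem_cocompact
  filter_upwards [h4] with z hz
  have : z - κ ≠ 0 := sub_ne_zero.2 hz
  rw [halfPlaneToDisc]
  field_simp
  ring

theorem differentiableOn_halfPlaneToDisc (hκ : κ.im < 0) :
    DifferentiableOn ℂ (halfPlaneToDisc p κ) {z | 0 ≤ z.im} :=
  (DifferentiableOn.div (by fun_prop) (by fun_prop)
    fun _ hz => sub_ne_zero_of_im_nonneg hκ hz).const_mul p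

theorem halfPlaneToDisc_mem_closedBall (hp : ‖p‖ = 1) (hκ : κ.im < 0) {t : ℝ} (ht : 0 ≤ t)
    {z : ℂ} (hz : t ≤ z.im) : halfPlaneToDisc p κ z ∈
      closedBall ((1 - (-κ.im / (-κ.im + t) : ℝ)) * p) (-κ.im / (-κ.im + t)) := by
  have hzκ := sub_ne_zero_of_im_nonneg hκ (ht.trans hz)
  have h := norm_halfPlaneToDisc_sub_sq hp hκ hzκ ht
  have hn := normSq_pos.2 hzκ
  have hk : 0 < -κ.im := by linarith
  rw [mem_closedBall, dist_eq_norm]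
  refine le_of_sq_le_sq ?_ (by positivity)
  rw [h]
  have : 0 ≤ 4 * -κ.im * (-κ.im / (-κ.im + t)) / normSq (z - κ) := by positivity
  nlinarith

theorem halfPlaneToDisc_mem_ball (hp : ‖p‖ = 1) (hκ : κ.im < 0) {t : ℝ} (ht : 0 ≤ t)
    {z : ℂ} (hz : t < z.im) : halfPlaneToDisc p κ z ∈
      ball ((1 - (-κ.im / (-κ.im + t) : ℝ)) * p) (-κ.im / (-κ.im + t)) := by
  have hzκ := sub_ne_zero_of_im_nonneg hκ (ht.trans hz.le)
  have h := norm_halfPlaneToDisc_sub_sq hp hκ hzκ ht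
  have hn := normSq_pos.2 hzκ
  have hk : 0 < -κ.im := by linarith
  rw [mem_ball, dist_eq_norm]
  refine lt_of_pow_lt_pow_left₀ 2 (by positivity) ?_
  rw [h]
  have : 0 < 4 * -κ.im * (-κ.im / (-κ.im + t)) / normSq (z - κ) := by positivity
  nlinarith

theorem halfPlaneToDisc_mem_sphere (hp : ‖p‖ = 1) (hκ : κ.im < 0) {z : ℂ} (hz : 0 ≤ z.im) :
    halfPlaneToDisc p κ z ∈
      sphere ((1 - (-κ.im / (-κ.im + z.im) : ℝ)) * p) (-κ.im / (-κ.im + z.im)) := by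
  have h := norm_halfPlaneToDisc_sub_sq hp hκ (sub_ne_zero_of_im_nonneg hκ hz) hz
  have hk : 0 < -κ.im := by linarith
  rw [mem_sphere, dist_eq_norm]
  rw [sub_self, mul_zero, add_zero] at h
  exact (pow_left_inj₀ (norm_nonneg _) (by positivity) two_ne_zero).1 h

theorem exists_halfPlaneToDisc_eq (hp : ‖p‖ = 1) (hκ : κ.im < 0) {w : ℂ}
    (hw : w ∈ ball (0 : ℂ) 1) : ∃ z : ℂ, 0 < z.im ∧ halfPlaneToDisc p κ z = w := by
  rw [mem_ball_zero_iff] at hw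
  have hwp : w - p ≠ 0 := fun h => by rw [sub_eq_zero.1 h] at hw; linarith
  have hp0 : p ≠ 0 := fun h => by simp [h] at hp
  have hκκ : κ - conj κ ≠ 0 := by
    intro h
    have := congrArg im h
    simp at this
    linarith
  set z : ℂ := (w * κ - p * conj κ) / (w - p) with hz
  have e1 : z - κ = p * (κ - conj κ) / (w - p) := by rw [hz]; field_simp; ring
  have hzκ : z - κ ≠ 0 := by
    rw [e1]; exact div_ne_zero (mul_ne_zero hp0 hκκ) hwp
  have e3 : z - conj κ = w * (κ - conj κ) / (w - p) := by rw [hz]; field_simp; ring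
  have e2 : halfPlaneToDisc p κ z = w := by
    rw [halfPlaneToDisc, e1, e3]; field_simp
  refine ⟨z, ?_, e2⟩
  have h := norm_halfPlaneToDisc_sq hp hκ hzκ
  rw [e2] at h
  have hn := normSq_pos.2 hzκ
  have hk : 0 < -κ.im := by linarith
  have h4 : 0 < 4 * -κ.im / normSq (z - κ) := by positivity
  by_contra hcon
  have h5 := not_lt.1 hcon
  nlinarith [norm_nonneg w]

/-- Since |κ| = 1, inversion sends the pole κ to -κ̄ and the zero κ̄ to -κ, so the two maps differ
by a constant factor, which κ² absorbs. -/
theorem halfPlaneToDisc_neg_inv {q : ℂ} (hκ1 : ‖κ‖ = 1) (hq : p = κ ^ 2 * q) {z : ℂ}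
    (hz0 : z ≠ 0) : halfPlaneToDisc q (-conj κ) (-z⁻¹) = halfPlaneToDisc p κ z := by
  have hκ0 : κ ≠ 0 := fun h => by simp [h] at hκ1
  have hc : conj κ = κ⁻¹ := by
    rw [inv_def, normSq_eq_norm_sq, hκ1]; simp
  rw [halfPlaneToDisc, halfPlaneToDisc, hq]
  simp only [map_neg, conj_conj]
  rw [hc]
  have h1 : -z⁻¹ - -κ = κ * (z - κ⁻¹) / z := by field_simp; ring
  have h2 : -z⁻¹ - -κ⁻¹ = κ⁻¹ * (z - κ) / z := by field_simp; ring
  rw [h1, h2]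
  -- At the pole both sides are 0 by the convention for division by zero.
  rcases eq_or_ne (z - κ) 0 with h | h
  · simp [h]
  · field_simp

/-- The height -Im κ (1 - r)/r is where the radius equals r. Since u vanishes on the unit circle,
extending it by zero below the real axis is continuous. -/
theorem exists_halfPlaneExt_pullback (hp : ‖p‖ = 1) (hκ : κ.im < 0) {r : ℝ} (hr : 0 < r)
    (hu : ContinuousOn u (closedBall 0 1)) (hu0 : ∀ z ∈ sphere (0 : ℂ) 1, u z = 0)
    (hext : ∀ ρ : ℝ, r ≤ ρ → ρ ≤ 1 → ExtendsHolomorphicallyFrom u ((1 - (ρ : ℂ)) * p) ρ) :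
    ∃ F, HalfPlaneExt (halfPlanePullback p κ u) (-κ.im * (1 - r) / r) F := by
  choose! g hgc hgd hge using hext
  have hk : 0 < -κ.im := by linarith
  have hup : u p = 0 := hu0 p (by simpa using hp)
  have hρ : ∀ t, 0 < t → t ≤ -κ.im * (1 - r) / r →
      r ≤ -κ.im / (-κ.im + t) ∧ -κ.im / (-κ.im + t) ≤ 1 := by
    intro t ht htT
    rw [le_div_iff₀ hr] at htT
    have : 0 < -κ.im + t := by linarith
    rw [le_div_iff₀ this, div_le_one this]
    exact ⟨by linarith, by linarith⟩
  have hMc : ContinuousOn (halfPlaneToDisc p κ) {z | 0 ≤ z.im} :=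
    (differentiableOn_halfPlaneToDisc hκ).continuousOn
  have hout : ∀ z : ℂ, z.im ≤ 0 → halfPlanePullback p κ u z = 0 := by
    intro z hz
    rw [halfPlanePullback]
    split_ifs with h
    · exact hu0 _ (by simpa using norm_halfPlaneToDisc_of_im_eq_zero hp hκ (le_antisymm hz h))
    · rfl
  refine ⟨fun t z => if 0 < t then g (-κ.im / (-κ.im + t)) (halfPlaneToDisc p κ z) else 0,
    ?_, ?_, ?_, ?_, ?_, ?_, ?_⟩
  · have hcl : IsClosed {z : ℂ | 0 ≤ z.im} := isClosed_le continuous_const continuous_im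
    have hcl' : IsClosed {z : ℂ | z.im ≤ 0} := isClosed_le continuous_im continuous_const
    have h1 : ContinuousOn (halfPlanePullback p κ u) {z | 0 ≤ z.im} :=
      (hu.comp hMc fun z hz => halfPlaneToDisc_mem_closedBall_zero hp hκ hz).congr
        fun z (hz : 0 ≤ z.im) => if_pos hz
    have h2 : ContinuousOn (halfPlanePullback p κ u) {z | z.im ≤ 0} :=
      continuousOn_const.congr hout
    rw [← continuousOn_univ]
    refine (h1.union_of_isClosed h2 hcl hcl').mono fun z _ => le_total 0 z.im
  · rw [Metric.tendsto_nhds]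
    intro ε hε
    have h1 : Tendsto (halfPlaneToDisc p κ) (cocompact ℂ ⊓ 𝓟 {z | 0 ≤ z.im})
        (𝓝[closedBall 0 1] p) := by
      refine tendsto_nhdsWithin_iff.2 ⟨tendsto_halfPlaneToDisc.mono_left inf_le_left, ?_⟩
      rw [eventually_inf_principal]
      exact Eventually.of_forall fun z hz => halfPlaneToDisc_mem_closedBall_zero hp hκ hz
    have h2 := (hu p (by simpa using hp.le)).tendsto.comp h1
    rw [hup] at h2
    have h3 := Metric.tendsto_nhds.1 h2 ε hε
    rw [eventually_inf_principal] at h3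
    filter_upwards [h3] with z hz
    rw [halfPlanePullback]
    split_ifs with h
    · exact hz h
    · simpa using hε
  · intro t ht z
    exact if_neg (not_lt.2 ht)
  · intro t htT
    rcases le_or_gt t 0 with ht | ht
    · simp only [if_neg (not_lt.2 ht)]; exact continuousOn_const
    simp only [if_pos ht]
    obtain ⟨q1, q2⟩ := hρ t ht htT
    exact (hgc _ q1 q2).comp (hMc.mono fun z (hz : t ≤ z.im) => ht.le.trans hz)
      fun z hz => halfPlaneToDisc_mem_closedBall hp hκ ht.le hz
  · intro t htT
    rcases le_or_gt t 0 with ht | ht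
    · simp only [if_neg (not_lt.2 ht)]; exact differentiableOn_const 0
    simp only [if_pos ht]
    obtain ⟨q1, q2⟩ := hρ t ht htT
    exact (hgd _ q1 q2).comp ((differentiableOn_halfPlaneToDisc hκ).mono
      fun z (hz : t < z.im) => ht.le.trans hz.le)
      fun z hz => halfPlaneToDisc_mem_ball hp hκ ht.le hz
  · intro t htT
    rcases le_or_gt t 0 with ht | ht
    · simp only [if_neg (not_lt.2 ht)]; exact tendsto_const_nhds
    simp only [if_pos ht]
    obtain ⟨q1, q2⟩ := hρ t ht htT
    set ρ := -κ.im / (-κ.im + t) with hρd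
    have hps : p ∈ sphere ((1 - (ρ : ℂ)) * p) ρ := by
      rw [mem_sphere, dist_eq_norm, show p - (1 - (ρ : ℂ)) * p = ρ * p by ring, norm_mul, hp,
        mul_one, norm_real, Real.norm_eq_abs, abs_of_pos (hr.trans_le q1)]
    -- Infinity corresponds to p, which lies on every circle of the family; there the extension
    -- equals u(p) = 0, whence decay at infinity.
    have h2 := hgc ρ q1 q2 p (sphere_subset_closedBall hps)
    rw [ContinuousWithinAt, hge ρ q1 q2 hps, hup] at h2
    refine h2.comp (tendsto_nhdsWithin_iff.2 ⟨tendsto_halfPlaneToDisc.mono_left inf_le_left, ?_⟩)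
    rw [eventually_inf_principal]
    exact Eventually.of_forall fun z hz => halfPlaneToDisc_mem_closedBall hp hκ ht.le hz
  · intro t htT z hz
    rcases le_or_gt t 0 with ht | ht
    · simp only [if_neg (not_lt.2 ht)]
      exact (hout z (hz.trans_le ht)).symm
    simp only [if_pos ht]
    obtain ⟨q1, q2⟩ := hρ t ht htT
    subst hz
    rw [halfPlanePullback, if_pos ht.le]
    exact hge _ q1 q2 (halfPlaneToDisc_mem_sphere hp hκ ht.le)

end HalfPlaneToDisc

/-! ### Conclusion in the disc. -/

theorem isCircleInDiscThrough_of_norm_eq_one {p : ℂ} (hp : ‖p‖ = 1) {ρ : ℝ} (hρ : 0 ≤ ρ)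
    (hρ1 : ρ ≤ 1) : IsCircleInDiscThrough p ((1 - (ρ : ℂ)) * p) ρ := by
  have hn : ‖(1 - (ρ : ℂ)) * p‖ = 1 - ρ := by
    rw [norm_mul, hp, mul_one, ← ofReal_one, ← ofReal_sub, norm_real, Real.norm_eq_abs,
      abs_of_nonneg (by linarith)]
  refine ⟨fun z hz => ?_, ?_⟩
  · rw [mem_sphere, dist_eq_norm] at hz
    rw [mem_closedBall_zero_iff]
    have := norm_add_le (z - (1 - (ρ : ℂ)) * p) ((1 - (ρ : ℂ)) * p)
    rw [sub_add_cancel] at this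
    linarith
  · rw [mem_sphere, dist_eq_norm, show p - (1 - (ρ : ℂ)) * p = ρ * p by ring, norm_mul, hp,
      mul_one, norm_real, Real.norm_eq_abs, abs_of_nonneg hρ]

theorem theorem5p2 (p₁ p₂ : ℂ) (hp₁ : p₁ ∈ Metric.sphere (0 : ℂ) 1)
    (hp₂ : p₂ ∈ Metric.sphere (0 : ℂ) 1) (hp : p₁ ≠ p₂)
    (r₁ r₂ : ℝ) (hr₁ : 0 < r₁) (hr₁' : r₁ < 1) (hr₂ : 0 < r₂) (hr₂' : r₂ < 1)
    (f : ℂ → ℂ) (hf : ContinuousOn f (Metric.closedBall 0 1))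
    (hf₁ : ∀ (c : ℂ) (ρ : ℝ), r₁ ≤ ρ → ρ ≤ 1 → IsCircleInDiscThrough p₁ c ρ →
      ExtendsHolomorphicallyFrom f c ρ)
    (hf₂ : ∀ (c : ℂ) (ρ : ℝ), r₂ ≤ ρ → ρ ≤ 1 → IsCircleInDiscThrough p₂ c ρ →
      ExtendsHolomorphicallyFrom f c ρ)
    (hdisj : ∀ c₁ c₂ : ℂ, IsCircleInDiscThrough p₁ c₁ r₁ → IsCircleInDiscThrough p₂ c₂ r₂ →
      Disjoint (Metric.sphere c₁ r₁) (Metric.sphere c₂ r₂)) :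
    DifferentiableOn ℂ f (Metric.ball 0 1) := by
  have hn₁ : ‖p₁‖ = 1 := by simpa using hp₁
  have hn₂ : ‖p₂‖ = 1 := by simpa using hp₂
  obtain ⟨h, hhc, hhd, hhe⟩ : ExtendsHolomorphicallyFrom f 0 1 := by
    have := hf₁ _ 1 hr₁'.le le_rfl (isCircleInDiscThrough_of_norm_eq_one hn₁ zero_le_one le_rfl)
    simpa using this
  let u : ℂ → ℂ := fun z => f z - h z
  have huc : ContinuousOn u (closedBall 0 1) := hf.sub hhc
  have hu0 : ∀ z ∈ sphere (0 : ℂ) 1, u z = 0 := fun z hz => sub_eq_zero.2 (hhe hz).symm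
  have hsubext : ∀ p : ℂ, ‖p‖ = 1 → ∀ ρ : ℝ, 0 < ρ → ρ ≤ 1 →
      ExtendsHolomorphicallyFrom f ((1 - (ρ : ℂ)) * p) ρ →
      ExtendsHolomorphicallyFrom u ((1 - (ρ : ℂ)) * p) ρ := by
    rintro p hp ρ hρ hρ1 ⟨g, hgc, hgd, hge⟩
    have hn : dist ((1 - (ρ : ℂ)) * p) 0 = 1 - ρ := by
      rw [dist_zero_right, norm_mul, hp, mul_one, ← ofReal_one, ← ofReal_sub, norm_real,
        Real.norm_eq_abs, abs_of_nonneg (by linarith)]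
    refine ⟨fun z => g z - h z, hgc.sub (hhc.mono (closedBall_subset_closedBall' ?_)),
      hgd.sub (hhd.mono (ball_subset_ball' ?_)), fun z hz => ?_⟩
    · rw [hn]; linarith
    · rw [hn]; linarith
    · simp only [u]; rw [hge hz]
  -- This square root sends 0 to p₂ under the map taking ∞ to p₁. A real root would force p₁ = p₂,
  -- and the sign is free.
  obtain ⟨κ, hκ, hκim⟩ : ∃ κ : ℂ, κ ^ 2 = p₁ * conj p₂ ∧ κ.im < 0 := by
    obtain ⟨κ, hκ⟩ := IsAlgClosed.exists_pow_nat_eq (p₁ * conj p₂) two_pos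
    rcases lt_trichotomy κ.im 0 with h | h | h
    · exact ⟨κ, hκ, h⟩
    · exfalso
      apply hp
      have hκr : κ = κ.re := by apply Complex.ext <;> simp [h]
      have hκn : κ.re ^ 2 = 1 := by
        have := congrArg norm hκ
        rw [norm_pow, norm_mul, norm_conj, hn₁, hn₂, hκr, norm_real, Real.norm_eq_abs, sq_abs]
          at this
        simpa using this
      have h1 : p₁ * conj p₂ = 1 := by
        rw [← hκ, hκr, ← ofReal_pow, hκn, ofReal_one]
      have h2 : conj p₂ * p₂ = 1 := by
        rw [conj_mul', hn₂]; simp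
      linear_combination p₂ * h1 - p₁ * h2
    · exact ⟨-κ, by rw [neg_sq, hκ], by simpa using h⟩
  have hκ1 : ‖κ‖ = 1 := by
    have := congrArg norm hκ
    rw [norm_pow, norm_mul, norm_conj, hn₁, hn₂, one_mul] at this
    exact (pow_eq_one_iff_of_nonneg (norm_nonneg _) two_ne_zero).1 this
  have hpp : p₁ = κ ^ 2 * p₂ := by
    have h2 : conj p₂ * p₂ = 1 := by
      rw [conj_mul', hn₂]; simp
    rw [hκ]
    linear_combination -p₁ * h2
  have hκim' : (-conj κ).im < 0 := by simpa using hκim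
  obtain ⟨F₁, hF₁⟩ := exists_halfPlaneExt_pullback hn₁ hκim hr₁ huc hu0 fun ρ h1 h2 =>
    hsubext p₁ hn₁ ρ (hr₁.trans_le h1) h2 (hf₁ _ ρ h1 h2
      (isCircleInDiscThrough_of_norm_eq_one hn₁ (hr₁.trans_le h1).le h2))
  obtain ⟨F₂, hF₂⟩ := exists_halfPlaneExt_pullback hn₂ hκim' hr₂ huc hu0 fun ρ h1 h2 =>
    hsubext p₂ hn₂ ρ (hr₂.trans_le h1) h2 (hf₂ _ ρ h1 h2
      (isCircleInDiscThrough_of_norm_eq_one hn₂ (hr₂.trans_le h1).le h2))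
  have him' : (-conj κ).im = κ.im := by simp
  rw [him'] at hF₂
  have hm : 0 < -κ.im := by linarith
  set T₁ := -κ.im * (1 - r₁) / r₁ with hT₁
  set T₂ := -κ.im * (1 - r₂) / r₂ with hT₂
  have hT₁0 : 0 < T₁ := div_pos (mul_pos hm (by linarith)) hr₁
  have hT₂0 : 0 < T₂ := div_pos (mul_pos hm (by linarith)) hr₂
  have hρ₁ : -κ.im / (-κ.im + T₁) = r₁ := by
    rw [div_eq_iff (by linarith), hT₁]; field_simp; ring
  have hρ₂ : -κ.im / (-κ.im + T₂) = r₂ := by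
    rw [div_eq_iff (by linarith), hT₂]; field_simp; ring
  have hTT : 1 < T₁ * T₂ := by
    by_contra hcon
    have hle := not_lt.1 hcon
    have hx : 0 ≤ T₁ / T₂ - T₁ ^ 2 := by
      rw [sub_nonneg, le_div_iff₀ hT₂0]; nlinarith
    -- A point with Im z = T₁ and |z|² = T₁/T₂ has Im(-1/z) = T₂, so its image lies on both smallest
    -- circles. It exists because T₁T₂ ≤ 1 means T₁² ≤ T₁/T₂.
    let z : ℂ := ⟨Real.sqrt (T₁ / T₂ - T₁ ^ 2), T₁⟩
    have hzn : normSq z = T₁ / T₂ := by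
      rw [normSq_apply, Real.mul_self_sqrt hx]; simp only [z]; ring
    have hz0 : z ≠ 0 := by
      rw [← normSq_pos, hzn]; positivity
    have hwim : (-z⁻¹).im = T₂ := by
      rw [im_neg_inv, hzn]
      simp only [z]; field_simp
    have m1 := halfPlaneToDisc_mem_sphere hn₁ hκim (z := z) hT₁0.le
    have m2 := halfPlaneToDisc_mem_sphere hn₂ hκim' (z := -z⁻¹) (by rw [hwim]; exact hT₂0.le)
    rw [show z.im = T₁ from rfl, hρ₁] at m1
    rw [hwim, him', hρ₂, halfPlaneToDisc_neg_inv hκ1 hpp hz0] at m2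
    exact (disjoint_left.1 (hdisj _ _
      (isCircleInDiscThrough_of_norm_eq_one hn₁ hr₁.le hr₁'.le)
      (isCircleInDiscThrough_of_norm_eq_one hn₂ hr₂.le hr₂'.le))) m1 m2
  have hrel : ∀ z ≠ 0, halfPlanePullback p₂ (-conj κ) u (-z⁻¹) = halfPlanePullback p₁ κ u z := by
    intro z hz
    have hn : 0 < normSq z := normSq_pos.2 hz
    simp only [halfPlanePullback, halfPlaneToDisc_neg_inv hκ1 hpp hz]
    congr 1
    rw [im_neg_inv, div_nonneg_iff]
    simp only [eq_iff_iff]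
    constructor
    · rintro (⟨h, -⟩ | ⟨-, h⟩)
      · exact h
      · exact absurd hn (not_lt.2 h)
    · exact fun h => Or.inl ⟨h, hn.le⟩
  have hfh : ∀ w ∈ ball (0 : ℂ) 1, f w = h w := by
    intro w hw
    obtain ⟨z, hz, rfl⟩ := exists_halfPlaneToDisc_eq hn₁ hκim hw
    have := hF₁.eq_zero_of_neg_inv hF₂ hT₁0 hT₂0 hrel hTT z
    rw [halfPlanePullback, if_pos hz.le] at this
    exact sub_eq_zero.1 this
  exact hhd.congr hfh
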